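/- Let $F$ be a field of characteristic different from $2$, let $A$ be a (finite-dimensional) central simple $F$-algebra, and let $\sigma$ be an $F$-linear involution on $A$ (orthogonal or symplectic). Let $K/F$ be a quadratic field extension with nontrivial automorphism $\iota$, and let $(B,\tau)=(A,\sigma)\otimes_F(K,\iota)$. Recall that an algebra with involution $(B,\tau)$ is called hyperbolic if there is an idempotent $e\in B$ with $\tau(e)=1-e$. If there is an embedding of $F$-algebras with involution $(K,\mathrm{id})\hookrightarrow(A,\sigma)$, i.e. an injective $F$-algebra homomorphism $f\colon K\to A$ with $\sigma(f(x))=f(x)$ for all $x\in K$, then $(B,\tau)$ is hyperbolic. Conversely, if $(B,\tau)$ is hyperbolic, then such an embedding exists, except in the case where $A$ is split of degree $\equiv 2 \pmod 4$ and $\sigma$ is symplectic. In this exceptional case $(B,\tau)$ is hyperbolic but there is no embedding $(K,\mathrm{id})\hookrightarrow(A,\sigma)$. -/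

import Mathlib

open scoped TensorProduct

universe u v w

/-- An involution on an `R`-algebra `A` that is linear over `R`: an `R`-linear
anti-multiplicative map of order at most two. When `R` is a field and `A` is a central simple
`R`-algebra, these are the involutions of the first kind. -/
structure LinInvolution (R : Type u) (A : Type v) [CommRing R] [Ring A] [Algebra R A] extends
    A →ₗ[R] A where
  map_mul' : ∀ x y : A, toFun (x * y) = toFun y * toFun x
  involutive' : ∀ x : A, toFun (toFun x) = x

namespace LinInvolution

instance {R : Type u} {A : Type v} [CommRing R] [Ring A] [Algebra R A] :
    CoeFun (LinInvolution R A) (fun _ => A → A) :=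
  ⟨fun σ => σ.toLinearMap⟩

/-- The identity, as an involution of a commutative algebra. -/
def identity (R : Type u) (K : Type v) [CommRing R] [CommRing K] [Algebra R K] :
    LinInvolution R K where
  toLinearMap := LinearMap.id
  map_mul' x y := mul_comm x y
  involutive' _ := rfl

/-- Every automorphism of a quadratic field extension has order at most two. -/
theorem quadratic_apply_apply {F : Type u} {K : Type v} [Field F] [Field K] [Algebra F K]
    (hK : Module.finrank F K = 2) (ι : K ≃ₐ[F] K) (x : K) : ι (ι x) = x := by
  have : FiniteDimensional F K := Module.finite_of_finrank_eq_succ hK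
  have h1 : Nat.card (K ≃ₐ[F] K) ≤ 2 := by
    rw [Nat.card_eq_fintype_card, ← hK]; exact AlgEquiv.card_le
  have h0 : 0 < Nat.card (K ≃ₐ[F] K) := Nat.card_pos
  have h2 : ι ^ 2 = 1 := by
    have h3 : ι ^ Nat.card (K ≃ₐ[F] K) = 1 := pow_card_eq_one'
    interval_cases h : Nat.card (K ≃ₐ[F] K)
    · rw [pow_one] at h3; rw [h3, one_pow]
    · exact h3
  rw [pow_two] at h2
  exact DFunLike.congr_fun h2 x

/-- An automorphism `ι` of a quadratic field extension `K` of `F`, as an `F`-linear involution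
of `K`. -/
def ofQuadratic {F : Type u} {K : Type v} [Field F] [Field K] [Algebra F K]
    (hK : Module.finrank F K = 2) (ι : K ≃ₐ[F] K) : LinInvolution F K where
  toLinearMap := ι.toLinearMap
  map_mul' x y := by
    change ι (x * y) = ι y * ι x
    rw [map_mul, mul_comm]
  involutive' x := quadratic_apply_apply hK ι x

/-- The tensor product `(A, σ) ⊗ (B, τ)` of algebras with involution; it sends `a ⊗ b` to
`σ a ⊗ τ b`. -/
def tensor {R : Type u} {A : Type v} {B : Type w} [CommRing R] [Ring A] [Algebra R A]
    [Ring B] [Algebra R B] (σ : LinInvolution R A) (τ : LinInvolution R B) :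
    LinInvolution R (A ⊗[R] B) where
  toLinearMap := TensorProduct.map σ.toLinearMap τ.toLinearMap
  map_mul' x y := by
    change TensorProduct.map σ.toLinearMap τ.toLinearMap (x * y) =
      TensorProduct.map σ.toLinearMap τ.toLinearMap y *
        TensorProduct.map σ.toLinearMap τ.toLinearMap x
    have hσ : ∀ a b : A, σ.toLinearMap (a * b) = σ.toLinearMap b * σ.toLinearMap a := σ.map_mul'
    have hτ : ∀ a b : B, τ.toLinearMap (a * b) = τ.toLinearMap b * τ.toLinearMap a := τ.map_mul'
    induction x with
    | zero => simp
    | add x₁ x₂ h₁ h₂ => rw [add_mul, map_add, map_add, h₁, h₂, mul_add]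
    | tmul a b =>
      induction y with
      | zero => simp
      | add y₁ y₂ h₁ h₂ => rw [mul_add, map_add, map_add, h₁, h₂, add_mul]
      | tmul c d => simp [Algebra.TensorProduct.tmul_mul_tmul, hσ, hτ]
  involutive' x := by
    change TensorProduct.map σ.toLinearMap τ.toLinearMap
      (TensorProduct.map σ.toLinearMap τ.toLinearMap x) = x
    have hσ : ∀ a : A, σ.toLinearMap (σ.toLinearMap a) = a := σ.involutive'
    have hτ : ∀ a : B, τ.toLinearMap (τ.toLinearMap a) = a := τ.involutive'
    induction x with
    | zero => simp
    | add x₁ x₂ h₁ h₂ => rw [map_add, map_add, h₁, h₂]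
    | tmul a b => simp [hσ, hτ]

/-- `(A, σ)` is hyperbolic: there is an idempotent `e` with `σ e = 1 - e`. -/
def IsHyperbolic {R : Type u} {A : Type v} [CommRing R] [Ring A] [Algebra R A]
    (σ : LinInvolution R A) : Prop :=
  ∃ e : A, e * e = e ∧ σ e = 1 - e

/-- There is an embedding of `R`-algebras with involution `(A, σ) ↪ (B, τ)`. -/
def Embeds {R : Type u} {A : Type v} {B : Type w} [CommRing R] [Ring A] [Algebra R A]
    [Ring B] [Algebra R B] (σ : LinInvolution R A) (τ : LinInvolution R B) : Prop :=
  ∃ f : A →ₐ[R] B, Function.Injective f ∧ ∀ x : A, f (σ x) = τ (f x)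

/-- An involution of the first kind on a central simple `F`-algebra `A` is symplectic if, for
every field extension `L` of `F` that splits `A` and every isomorphism of
`(A_L, σ_L)` with `(End_L V, ad_b)`, where `ad_b` is the involution adjoint to a nondegenerate
bilinear form `b` on `V`, the form `b` is alternating. -/
def IsSymplectic {F : Type u} {A : Type v} [Field F] [Ring A] [Algebra F A]
    (σ : LinInvolution F A) : Prop :=
  ∀ (L : Type u) [Field L] [Algebra F L]
    (V : Type u) [AddCommGroup V] [Module L V] [FiniteDimensional L V]
    (φ : (L ⊗[F] A) ≃ₐ[L] Module.End L V) (b : LinearMap.BilinForm L V),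
    b.Nondegenerate →
    (∀ (a : L ⊗[F] A) (x y : V), b x (φ a y) = b (φ (σ.toLinearMap.baseChange L a) x) y) →
    b.IsAlt

end LinInvolution

/-- The degree of a central simple algebra: the square root of its dimension. -/
noncomputable def csaDegree (F : Type u) (A : Type v) [Field F] [Ring A] [Algebra F A] : ℕ :=
  Nat.sqrt (Module.finrank F A)

/-- `A` is split: it is isomorphic to a matrix algebra over `F`. -/
def IsSplitAlgebra (F : Type u) (A : Type v) [Field F] [Ring A] [Algebra F A] : Prop :=
  ∃ n : ℕ, Nonempty (A ≃ₐ[F] Matrix (Fin n) (Fin n) F)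

/-- The exceptional case: `A` is split of degree congruent to `2` modulo `4` and `σ` is
symplectic. -/
def IsExceptionalCase {F : Type u} {A : Type v} [Field F] [Ring A] [Algebra F A]
    (σ : LinInvolution F A) : Prop :=
  IsSplitAlgebra F A ∧ csaDegree F A % 4 = 2 ∧ σ.IsSymplectic

/-! Write `K = F(α)` with `α² = d` and `ι α = -α`. An embedding of `(K, id)` is the same as a
symmetric `s ∈ A` with `s² = d`. Given `s`, the element `(1 + d⁻¹ s ⊗ α) / 2` is a hyperbolic
idempotent of `B`. Conversely, splitting a hyperbolic idempotent into its `1` and `α` coordinates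
yields a skew `x` and a symmetric `y` that anticommute and satisfy `x² + d y² = 1`.

If `y` were invertible, `s = y⁻¹(1 + x)` would do. In general, the Fitting projection `e` for the
eigenvalue `1` of `x` is orthogonal to `σ e`, the projection for `-1`, and `y` is invertible on the
complement of `e + σ e` (`exists_isotropic_idempotent_hasSymmSqrt_compl`). What remains is to find a
square root of `d` on the hyperbolic part.

Fix an idempotent `e₀` whose corner is a division ring. If `e₀A` contains a nonzero symmetric
element, each hyperbolic plane carries an off-diagonal square root, and these add up
(`hasSymmSqrt_of_symm_ne_zero`). Otherwise the situation is alternating: the corner is commutative,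
`A` is split, `σ` is symplectic, and `1` is an orthogonal sum of planes. Square roots are then built
on two planes at a time (`hyperbolic_of_alternating`), which suffices unless the number of planes is
odd, that is, unless the degree is `2` modulo `4`.

In the exceptional case `(A, σ)` is already hyperbolic, hence so is `B`. An embedding would make the
underlying symplectic space a `K`-space with a nondegenerate skew `K`-bilinear form, forcing `4` to
divide its `F`-dimension (`four_dvd_finrank_of_selfadjoint_quadratic`). -/

/-! ### Fitting decomposition -/

open Polynomial in
/-- Fitting decomposition of `x - 1` by polynomials in `x`. -/
theorem exists_fitting_polynomial {F : Type u} {A : Type v} [Field F] [Ring A] [Algebra F A]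
    [FiniteDimensional F A] (x : A) :
    ∃ (E T : F[X]) (N : ℕ), aeval x (E * E) = aeval x E ∧ aeval x ((X - 1) ^ N * E) = 0 ∧
      aeval x (1 - E) = aeval x ((X - 1) * T) := by
  have hμ : minpoly F x ≠ 0 := minpoly.ne_zero (Algebra.IsIntegral.isIntegral x)
  obtain ⟨r, hr, hdvd⟩ := exists_eq_pow_rootMultiplicity_mul_and_not_dvd (minpoly F x) hμ 1
  set k := rootMultiplicity 1 (minpoly F x)
  rw [C_1] at hr hdvd
  have hirr : Irreducible (X - 1 : F[X]) := by simpa using irreducible_X_sub_C (1 : F)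
  -- The exponent `k + 1`, rather than `k`, leaves a factor `X - 1` in `1 - E` even when `1` is not
  -- a root.
  have hcop : IsCoprime ((X - 1 : F[X]) ^ (k + 1)) r :=
    ((hirr.coprime_iff_not_dvd).2 hdvd).pow_left
  obtain ⟨a, b, hab⟩ := hcop
  have h0 : aeval x ((X - 1 : F[X]) ^ k * r) = 0 := by rw [← hr, minpoly.aeval]
  refine ⟨b * r, a * (X - 1) ^ k, k, ?_, ?_, ?_⟩
  · have : b * r * (b * r) = b * r - (a * b * (X - 1)) * ((X - 1) ^ k * r) := by
      linear_combination (b * r) * hab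
    rw [this, map_sub, map_mul _ (a * b * (X - 1)), h0, mul_zero, sub_zero]
  · have : (X - 1) ^ k * (b * r) = b * ((X - 1) ^ k * r) := by ring
    rw [this, map_mul, h0, mul_zero]
  · congr 1
    linear_combination -hab

/-! ### Symmetric square roots off the eigenvalues `1` and `-1` -/

namespace LinInvolution

section Basic

variable {F : Type u} {A : Type v} [CommRing F] [Ring A] [Algebra F A] (σ : LinInvolution F A)

theorem apply_mul (x y : A) : σ (x * y) = σ y * σ x := σ.map_mul' x y

theorem apply_apply (x : A) : σ (σ x) = x := σ.involutive' x

theorem apply_one : σ 1 = 1 := by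
  have h := σ.apply_mul (σ 1) 1
  rwa [mul_one, σ.apply_apply, mul_one, eq_comm] at h

theorem apply_ne_zero {x : A} (h : x ≠ 0) : σ x ≠ 0 := fun h0 => h <| by
  rw [← σ.apply_apply x, h0, map_zero]

theorem apply_algebraMap (r : F) : σ (algebraMap F A r) = algebraMap F A r := by
  rw [Algebra.algebraMap_eq_smul_one, map_smul, apply_one]

open Polynomial in
theorem apply_aeval_of_skew {x : A} (hx : σ x = -x) (P : F[X]) :
    σ (aeval x P) = aeval x (P.comp (-X)) := by
  induction P using Polynomial.induction_on' with
  | add P Q hP hQ => rw [map_add, map_add, hP, hQ, add_comp, map_add]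
  | monomial n a =>
    have hpow : ∀ n : ℕ, σ (x ^ n) = (-x) ^ n := by
      intro n
      induction n with
      | zero => simp [apply_one]
      | succ n ih => rw [pow_succ, apply_mul, ih, hx, pow_succ']
    simp [apply_mul, hpow, apply_algebraMap, Algebra.commutes, ← C_mul_X_pow_eq_monomial]

end Basic

/-- The corner at the symmetric idempotent `p` contains a symmetric square root of `d`. -/
def HasSymmSqrt {F : Type u} {A : Type v} [CommRing F] [Ring A] [Algebra F A]
    (σ : LinInvolution F A) (d : F) (p : A) : Prop :=
  ∃ s : A, σ s = s ∧ s * s = d • p ∧ p * s = s ∧ s * p = s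

section Field

variable {F : Type u} {A : Type v} [Field F] [Ring A] [Algebra F A] {σ : LinInvolution F A}

theorem HasSymmSqrt.zero (d : F) : σ.HasSymmSqrt d 0 := ⟨0, by simp⟩

theorem HasSymmSqrt.add {d : F} {p q : A} (hp : σ.HasSymmSqrt d p) (hq : σ.HasSymmSqrt d q)
    (hpq : p * q = 0) (hqp : q * p = 0) : σ.HasSymmSqrt d (p + q) := by
  obtain ⟨s, hs, hss, hps, hsp⟩ := hp
  obtain ⟨t, ht, htt, hqt, htq⟩ := hq
  have hst : s * t = 0 := by rw [← hsp, ← hqt, mul_assoc, ← mul_assoc p, hpq]; simp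
  have hts : t * s = 0 := by rw [← htq, ← hps, mul_assoc, ← mul_assoc q, hqp]; simp
  have hpt : p * t = 0 := by rw [← hqt, ← mul_assoc, hpq, zero_mul]
  have hqs : q * s = 0 := by rw [← hps, ← mul_assoc, hqp, zero_mul]
  have htp : t * p = 0 := by rw [← htq, mul_assoc, hqp, mul_zero]
  have hsq : s * q = 0 := by rw [← hsp, mul_assoc, hpq, mul_zero]
  refine ⟨s + t, by rw [map_add, hs, ht], ?_, ?_, ?_⟩ <;>
    simp only [mul_add, add_mul, smul_add, *, add_zero, zero_add]

open Polynomial in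
theorem mul_aeval_of_anticomm {x y : A} (h : y * x = -x * y) (P : F[X]) :
    y * aeval x P = aeval x (P.comp (-X)) * y := by
  induction P using Polynomial.induction_on' with
  | add P Q hP hQ => rw [map_add, mul_add, hP, hQ, add_comp, map_add, add_mul]
  | monomial n a =>
    have hpow : y * x ^ n = (-x) ^ n * y := (show SemiconjBy y x (-x) from h).pow_right n
    simp only [← C_mul_X_pow_eq_monomial, mul_comp, C_comp, pow_comp, X_comp,
      map_mul, map_pow, map_neg, aeval_X, aeval_C]
    rw [mul_assoc, ← hpow, ← mul_assoc, ← mul_assoc, Algebra.commutes]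

-- On the part where `x² - 1` is invertible, the relation `1 - x² = d y²` makes `y` invertible, and
-- `y⁻¹(1 + x)` is symmetric with square `y⁻²(1 - x)(1 + x) = d`. The rest is the generalized
-- eigenspaces for `1` and `-1`, which `σ` exchanges because `x` is skew.
open Polynomial in
theorem exists_isotropic_idempotent_hasSymmSqrt_compl [FiniteDimensional F A] (h2 : (2 : F) ≠ 0)
    {d : F} {x y : A} (hx : σ x = -x) (hy : σ y = y) (hsq : x * x + d • (y * y) = 1)
    (hxy : y * x = -x * y) :
    ∃ e : A, e * e = e ∧ e * σ e = 0 ∧ σ e * e = 0 ∧ σ.HasSymmSqrt d (1 - (e + σ e)) := by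
  obtain ⟨E, T, N, hE, hNE, hT⟩ := exists_fitting_polynomial (F := F) x
  have hcc : ∀ P : F[X], (P.comp (-X)).comp (-X) = P := fun P => by simp [comp_assoc]
  have hσ : ∀ P : F[X], σ (aeval x P) = aeval x (P.comp (-X)) := σ.apply_aeval_of_skew hx
  have hcomm : ∀ P Q : F[X], aeval x P * aeval x Q = aeval x Q * aeval x P := fun P Q => by
    rw [← map_mul, mul_comm, map_mul]
  set E' := E.comp (-X) with hE'
  set T' := T.comp (-X) with hT'
  have hNE' : aeval x ((-X - 1) ^ N * E') = 0 := by
    have := congrArg (fun z => σ z) hNE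
    simp only [hσ, map_zero] at this
    simpa using this
  have hT1 : aeval x (1 - E') = aeval x ((-X - 1) * T') := by
    have := congrArg (fun z => σ z) hT
    simp only [hσ] at this
    simpa using this
  -- This is where characteristic not two enters: `X - 1` and `-X - 1` are coprime.
  have hEE' : aeval x (E * E') = 0 := by
    have hcop : IsCoprime ((X - 1 : F[X]) ^ N) ((-X - 1) ^ N) := by
      refine IsCoprime.pow ⟨C (-(1 / 2)), C (-(1 / 2)), ?_⟩
      have : (C (1 / 2) : F[X]) * 2 = 1 := by
        rw [show (2 : F[X]) = C 2 from rfl, ← C_mul, one_div, inv_mul_cancel₀ h2, C_1]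
      rw [C_neg]
      linear_combination this
    obtain ⟨a, b, hab⟩ := hcop
    have : E * E' = a * E' * ((X - 1) ^ N * E) + b * E * ((-X - 1) ^ N * E') := by
      linear_combination -(E * E') * hab
    rw [this, map_add, map_mul _ (a * E'), hNE, map_mul _ (b * E), hNE', mul_zero, mul_zero, add_zero]
  have heσ : aeval x E * σ (aeval x E) = 0 := by rw [hσ, ← map_mul, hEE']
  have hσe : σ (aeval x E) * aeval x E = 0 := by rw [hσ, ← map_mul, mul_comm, hEE']
  refine ⟨aeval x E, by rw [← map_mul, hE], heσ, hσe, ?_⟩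
  have hyP : ∀ P : F[X], P.comp (-X) = P → aeval x P * y = y * aeval x P := fun P hP => by
    rw [mul_aeval_of_anticomm hxy, hP]
  set p : A := 1 - (aeval x E + σ (aeval x E)) with hp
  have hp' : p = aeval x ((1 - E) * (1 - E')) := by
    rw [show (1 - E) * (1 - E') = 1 - (E + E') + E * E' by ring, map_add, hEE', add_zero, hp, hσ]
    simp [hE']
  have hpE : ((1 - E) * (1 - E')).comp (-X) = (1 - E) * (1 - E') := by
    simp only [mul_comp, sub_comp, one_comp, ← hE']
    rw [hE', hcc, mul_comm]
  have hpp : p * p = p := by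
    have h1 : ∀ P : F[X], aeval x (P * P) = aeval x P →
        aeval x ((1 - P) * (1 - P)) = aeval x (1 - P) := fun P hP => by
      rw [show (1 - P) * (1 - P) = 1 - P - P + P * P by ring, map_add, hP, map_sub]; simp
    have hE'E' : aeval x (E' * E') = aeval x E' := by
      have := congrArg (fun z => σ z) hE
      simp only [hσ] at this
      simpa using this
    rw [hp', ← map_mul, show (1 - E) * (1 - E') * ((1 - E) * (1 - E')) =
      ((1 - E) * (1 - E)) * ((1 - E') * (1 - E')) by ring, map_mul, h1 E hE, h1 E' hE'E', map_mul]
  -- `p = (1 - x²) T T' = d y² T T'`, so `t` inverts `y²` on the corner of `p`.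
  set t : A := d • aeval x (T * T') with ht
  have hTT : (T * T').comp (-X) = T * T' := by
    rw [mul_comp, hT', hcc, mul_comm]
  have hty : t * y = y * t := by rw [ht, smul_mul_assoc, hyP _ hTT, mul_smul_comm]
  have htx : t * x = x * t := by
    have := hcomm (T * T') X
    rw [aeval_X] at this
    rw [ht, smul_mul_assoc, this, mul_smul_comm]
  have hpy : p * y = y * p := by rw [hp', hyP _ hpE]
  have hpx : p * x = x * p := by
    have := hcomm ((1 - E) * (1 - E')) X
    rwa [aeval_X, ← hp'] at this
  have htp : t * p = p * t := by rw [ht, hp', smul_mul_assoc, hcomm, mul_smul_comm]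
  have hσt : σ t = t := by rw [ht, map_smul, hσ, hTT]
  have hσp : σ p = p := by rw [hp', hσ, hpE]
  have hpyt : p = y * y * t := by
    have h1 : aeval x (1 - X ^ 2 : F[X]) = d • (y * y) := by
      rw [map_sub, map_pow, aeval_X, map_one, ← hsq, pow_two]; abel
    rw [hp', map_mul, hT, hT1, ← map_mul,
      show (X - 1) * T * ((-X - 1) * T') = (1 - X ^ 2) * (T * T') by ring, map_mul, h1, ht,
      smul_mul_assoc, mul_smul_comm]
  have hxx : x * x = 1 - d • (y * y) := by rw [← hsq]; abel
  obtain ⟨c, hc⟩ : ∃ c, c = t * p := ⟨_, rfl⟩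
  have hcy : c * y = y * c := by rw [hc, mul_assoc, hpy, ← mul_assoc, hty, mul_assoc]
  have hcx : c * x = x * c := by rw [hc, mul_assoc, hpx, ← mul_assoc, htx, mul_assoc]
  have hcz : c * (y * (1 + x)) = (y * (1 + x)) * c := by
    rw [← mul_assoc, hcy, mul_assoc, mul_add, hcx, mul_one, mul_assoc, add_mul, one_mul]
  have hσc : σ c = c := by rw [hc, apply_mul, hσt, hσp, htp]
  have hz : (y * (1 + x)) * (y * (1 + x)) = d • ((y * y) * (y * y)) := by
    have h1 : (1 + x) * y = y * (1 - x) := by rw [add_mul, mul_sub, hxy]; simp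
    calc (y * (1 + x)) * (y * (1 + x)) = y * ((1 + x) * y) * (1 + x) := by noncomm_ring
      _ = (y * y) * (1 - x * x) := by rw [h1]; noncomm_ring
      _ = _ := by rw [hxx, sub_sub_cancel, mul_smul_comm]
  have hpc : p * c = c := by rw [hc, htp, ← mul_assoc, hpp]
  have hcp : c * p = c := by rw [hc, mul_assoc, hpp]
  -- Since `c` is `y⁻²` on the corner, this is `y⁻¹(1 + x)` written without inverting `y` globally.
  refine ⟨c * (y * (1 + x)), ?_, ?_, by rw [← mul_assoc, hpc], ?_⟩
  · rw [apply_mul, apply_mul, hσc, hy, map_add, hx, apply_one, hcz]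
    congr 1
    rw [add_mul, mul_add, hxy]; simp
  · have h3 : t * (y * y) = p := by rw [hpyt, ← mul_assoc, hty, mul_assoc, hty, mul_assoc]
    calc c * (y * (1 + x)) * (c * (y * (1 + x)))
        = c * c * ((y * (1 + x)) * (y * (1 + x))) := by
          rw [mul_assoc, ← mul_assoc _ c, ← hcz]; simp only [mul_assoc]
      _ = d • (c * c * ((y * y) * (y * y))) := by rw [hz, mul_smul_comm]
      _ = d • p := by
          congr 1
          have hcyy : c * (y * y) = p := by
            rw [hc, htp, mul_assoc, h3, hpp]
          have hcyy' : c * (y * y) = (y * y) * c := by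
            rw [← mul_assoc, hcy, mul_assoc, hcy, mul_assoc]
          rw [mul_assoc, ← mul_assoc c (y * y), hcyy, ← mul_assoc, hcp, hcyy]
  · rw [hcz, mul_assoc, hcp]

end Field
end LinInvolution

/-! ### Ranks of idempotents -/

section RightIdealRank

variable (F : Type u) {A : Type v} [Field F] [Ring A] [Algebra F A]

/-- The dimension of the right ideal `pA`. -/
noncomputable def rightIdealRank (p : A) : ℕ :=
  Module.finrank F (LinearMap.range (LinearMap.mulLeft F p))

variable [FiniteDimensional F A]

theorem rightIdealRank_pos {p : A} (hp : p ≠ 0) : 0 < rightIdealRank F p := by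
  refine Module.finrank_pos_iff_exists_ne_zero.2 ⟨⟨p, 1, by simp⟩, ?_⟩
  simpa [Subtype.ext_iff] using hp

theorem rightIdealRank_add {p q : A} (hp : p * p = p) (hq : q * q = q) (hpq : p * q = 0)
    (hqp : q * p = 0) : rightIdealRank F (p + q) = rightIdealRank F p + rightIdealRank F q := by
  have hsup : LinearMap.range (LinearMap.mulLeft F (p + q)) =
      LinearMap.range (LinearMap.mulLeft F p) ⊔ LinearMap.range (LinearMap.mulLeft F q) := by
    apply le_antisymm
    · rintro _ ⟨a, rfl⟩
      rw [LinearMap.mulLeft_apply, add_mul]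
      exact Submodule.add_mem_sup ⟨a, rfl⟩ ⟨a, rfl⟩
    · refine sup_le ?_ ?_
      · rintro _ ⟨a, rfl⟩
        exact ⟨p * a, by simp [← mul_assoc, add_mul, hp, hqp]⟩
      · rintro _ ⟨a, rfl⟩
        exact ⟨q * a, by simp [← mul_assoc, add_mul, hq, hpq]⟩
  have hinf : LinearMap.range (LinearMap.mulLeft F p) ⊓ LinearMap.range (LinearMap.mulLeft F q)
      = ⊥ := by
    rw [eq_bot_iff]
    rintro _ ⟨⟨a, rfl⟩, b, hb⟩
    simp only [LinearMap.mulLeft_apply] at hb ⊢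
    have : p * (p * a) = 0 := by rw [← hb, ← mul_assoc, hpq, zero_mul]
    rwa [← mul_assoc, hp] at this
  have := Submodule.finrank_sup_add_finrank_inf_eq (LinearMap.range (LinearMap.mulLeft F p))
    (LinearMap.range (LinearMap.mulLeft F q))
  rwa [hinf, finrank_bot, add_zero, ← hsup] at this

/-- Left multiplication by `v` carries `wvA` onto a space containing `vwA`. With both products
idempotent this gives equal ranks for equivalent idempotents. -/
theorem rightIdealRank_mul_le {v w : A} (h : v * w * (v * w) = v * w) :
    rightIdealRank F (v * w) ≤ rightIdealRank F (w * v) := by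
  have : LinearMap.range (LinearMap.mulLeft F (v * w)) ≤
      (LinearMap.range (LinearMap.mulLeft F (w * v))).map (LinearMap.mulLeft F v) := by
    rintro _ ⟨a, rfl⟩
    refine ⟨w * v * (w * a), ⟨w * a, rfl⟩, ?_⟩
    simp only [LinearMap.mulLeft_apply, ← mul_assoc] at h ⊢
    rw [h]
  exact (Submodule.finrank_mono this).trans (Submodule.finrank_map_le _ _)

theorem rightIdealRank_mul_comm {v w : A} (h : v * w * (v * w) = v * w)
    (h' : w * v * (w * v) = w * v) : rightIdealRank F (v * w) = rightIdealRank F (w * v) :=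
  le_antisymm (rightIdealRank_mul_le F h) (rightIdealRank_mul_le F h')

omit [FiniteDimensional F A] in
theorem rightIdealRank_one : rightIdealRank F (1 : A) = Module.finrank F A := by
  rw [rightIdealRank, LinearMap.mulLeft_one, LinearMap.range_id, finrank_top]

end RightIdealRank

/-! ### Division idempotents in a simple ring -/

/-- Simple rings are prime: the left annihilator of `Ay` is a two-sided ideal, so once it contains
`x ≠ 0` it contains `1`. -/
theorem eq_zero_of_forall_mul_mul_eq_zero {A : Type v} [Ring A] [IsSimpleRing A] {x y : A}
    (hx : x ≠ 0) (h : ∀ a, x * a * y = 0) : y = 0 := by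
  let I : TwoSidedIdeal A := TwoSidedIdeal.mk' {z | ∀ a, z * a * y = 0} (by simp)
    (fun hz hz' a => by rw [add_mul, add_mul, hz, hz', add_zero])
    (fun hz a => by rw [neg_mul, neg_mul, hz, neg_zero])
    (fun {b z} hz a => by rw [mul_assoc b, mul_assoc b, hz, mul_zero])
    (fun {z b} hz a => by rw [mul_assoc z, hz])
  have hmem : x ∈ I := by simpa [I, TwoSidedIdeal.mem_mk'] using h
  have h1 : (1 : A) ∈ I := IsSimpleRing.one_mem_of_ne_zero_mem I hx hmem
  have h2 : ∀ a, 1 * a * y = 0 := by simpa [I, TwoSidedIdeal.mem_mk'] using h1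
  simpa using h2 1

/-- An idempotent whose corner ring is a division ring. -/
structure IsDivisionIdempotent {A : Type v} [Ring A] (e : A) : Prop where
  idem : e * e = e
  ne_zero : e ≠ 0
  exists_inv : ∀ a, e * a * e ≠ 0 → ∃ b, e * a * e * (e * b * e) = e

namespace IsDivisionIdempotent

variable {A : Type v} [Ring A] {e : A}

theorem exists_left_inv (he : IsDivisionIdempotent e) {a : A} (ha : e * a * e ≠ 0) :
    ∃ b, e * b * e * (e * a * e) = e := by
  obtain ⟨b, hb⟩ := he.exists_inv a ha
  have hb0 : e * b * e ≠ 0 := fun h => he.ne_zero <| by rw [← hb, h, mul_zero]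
  obtain ⟨c, hc⟩ := he.exists_inv b hb0
  have hl : ∀ z, e * (e * z * e) = e * z * e := fun z => by
    rw [mul_assoc, ← mul_assoc e e, he.idem]
  have hr : ∀ z, (e * z * e) * e = e * z * e := fun z => by rw [mul_assoc, he.idem]
  have hac : e * a * e = e * c * e := by
    calc e * a * e = e * a * e * (e * b * e * (e * c * e)) := by rw [hc, hr]
      _ = e * c * e := by rw [← mul_assoc, hb, hl]
  exact ⟨b, by rw [hac, hc]⟩

theorem eq_of_idem (he : IsDivisionIdempotent e) {g : A} (hg : g * g = g) (h0 : g ≠ 0)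
    (h1 : e * g = g) (h2 : g * e = g) : g = e := by
  obtain ⟨b, hb⟩ := he.exists_inv g (by rwa [h1, h2])
  rw [h1, h2] at hb
  rw [← hb]
  nth_rw 2 [← hg]
  rw [mul_assoc, hb, h2]

/-- Primeness gives a nonzero path from `e` through `f` back to `e`, and it can be normalised in the
division corner. The product `v * w` is then an idempotent below `f` equivalent to `e`. -/
theorem exists_factor [IsSimpleRing A] (he : IsDivisionIdempotent e) {f : A} (hf : f * f = f)
    (h0 : f ≠ 0) : ∃ v w, e * w = w ∧ v * e = v ∧ w * v = e ∧ f * v = v ∧ w * f = w := by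
  obtain ⟨a, ha⟩ : ∃ a, f * a * e ≠ 0 := by
    by_contra! h
    exact he.ne_zero (eq_zero_of_forall_mul_mul_eq_zero h0 h)
  obtain ⟨b, hb⟩ : ∃ b, e * b * (f * a * e) ≠ 0 := by
    by_contra! h
    exact ha (eq_zero_of_forall_mul_mul_eq_zero he.ne_zero h)
  obtain ⟨c, hc⟩ := he.exists_left_inv (a := b * f * a) (by simpa only [mul_assoc] using hb)
  refine ⟨f * a * e, e * c * e * e * b * f, ?_, ?_, ?_, ?_, ?_⟩
  · simp only [← mul_assoc, he.idem]
  · rw [mul_assoc, he.idem]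
  · refine Eq.trans ?_ hc
    simp only [← mul_assoc]
    rw [mul_assoc _ f f, hf]
  · simp only [← mul_assoc, hf]
  · rw [mul_assoc, hf]

end IsDivisionIdempotent

/-! ### Hyperbolic idempotents in the presence of a symmetric element -/

namespace LinInvolution

section Ring

variable {F : Type u} {A : Type v} [CommRing F] [Ring A] [Algebra F A] {σ : LinInvolution F A}

/-- With respect to `e` and `σ e`, the square root is the off-diagonal block matrix with entries `c`
and `d • c'`, where `c` and `c'` are mutually inverse. -/
theorem hasSymmSqrt_of_pairing (d : F) {e c c' : A} (heσ : e * σ e = 0)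
    (hσe : σ e * e = 0) (hec : e * c = c) (hc : σ c = c) (hc'e : c' * e = c') (hc' : σ c' = c')
    (hcc' : c * c' = e) : σ.HasSymmSqrt d (e + σ e) := by
  have hc'c : c' * c = σ e := by rw [← hcc', apply_mul, hc, hc']
  have hce : c * σ e = c := by rw [← hc, ← apply_mul, hec]
  have hec' : σ e * c' = c' := by rw [← hc', ← apply_mul, hc'e]
  have h1 : c * c = 0 := by
    calc c * c = (c * σ e) * (e * c) := by rw [hce, hec]
      _ = 0 := by rw [mul_assoc, ← mul_assoc (σ e), hσe, zero_mul, mul_zero]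
  have h2 : c' * c' = 0 := by
    calc c' * c' = (c' * e) * (σ e * c') := by rw [hc'e, hec']
      _ = 0 := by rw [mul_assoc, ← mul_assoc e, heσ, zero_mul, mul_zero]
  have h3 : σ e * c = 0 := by rw [← hec, ← mul_assoc, hσe, zero_mul]
  have h4 : c * e = 0 := by rw [← hce, mul_assoc, hσe, mul_zero]
  have h5 : e * c' = 0 := by rw [← hec', ← mul_assoc, heσ, zero_mul]
  have h6 : c' * σ e = 0 := by rw [← hc'e, mul_assoc, heσ, mul_zero]
  refine ⟨c + d • c', by rw [map_add, map_smul, hc, hc'], ?_, ?_, ?_⟩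
  · simp only [mul_add, add_mul, mul_smul_comm, smul_mul_assoc, smul_add, *, add_zero, zero_add,
      smul_zero]
    rw [add_comm]
  · simp only [add_mul, mul_add, mul_smul_comm, *, add_zero, zero_add]
  · simp only [add_mul, mul_add, smul_mul_assoc, *, add_zero, zero_add, smul_zero]
    rw [add_comm]

end Ring

variable {F : Type u} {A : Type v} [Field F] [Ring A] [Algebra F A] {σ : LinInvolution F A}
  {e₀ : A}

/-- A nonzero `c` in `e₀ A σ(e₀)` is a nonzero map between simple right ideals, hence an
isomorphism. -/
theorem exists_inverse_of_ne_zero [IsSimpleRing A] (he₀ : IsDivisionIdempotent e₀) {c : A}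
    (h0 : c ≠ 0) (h1 : e₀ * c = c) (h2 : c * σ e₀ = c) :
    ∃ c', σ e₀ * c' = c' ∧ c' * e₀ = c' ∧ c * c' = e₀ ∧ c' * c = σ e₀ := by
  obtain ⟨a, ha⟩ : ∃ a, c * a * e₀ ≠ 0 := by
    by_contra! h
    exact he₀.ne_zero (eq_zero_of_forall_mul_mul_eq_zero h0 h)
  obtain ⟨b, hb⟩ := he₀.exists_inv (c * a) (by rwa [← mul_assoc, h1])
  have hσ0 : σ e₀ * σ e₀ = σ e₀ := by rw [← apply_mul, he₀.idem]
  obtain ⟨c', hc'⟩ : ∃ c', c' = σ e₀ * a * e₀ * (e₀ * b * e₀) := ⟨_, rfl⟩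
  have hcc' : c * c' = e₀ := by
    rw [← hb, hc']
    simp only [← mul_assoc]
    rw [h1, h2]
  have hl : σ e₀ * c' = c' := by rw [hc']; simp only [← mul_assoc, hσ0]
  have hr : c' * e₀ = c' := by rw [hc', mul_assoc, mul_assoc (e₀ * b), he₀.idem]
  refine ⟨c', hl, hr, hcc', ?_⟩
  -- Applying `σ` moves the idempotent `c' * c` into the `e₀` corner, whose only nonzero idempotent
  -- is `e₀`.
  have hg : σ (c' * c) = e₀ := by
    refine he₀.eq_of_idem ?_ ?_ ?_ ?_
    · rw [← apply_mul, mul_assoc, ← mul_assoc c, hcc', h1]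
    · refine σ.apply_ne_zero fun h => h0 ?_
      rw [← h1, ← hcc', mul_assoc, h, mul_zero]
    · nth_rw 1 [← σ.apply_apply e₀]
      rw [← apply_mul, mul_assoc, h2]
    · nth_rw 1 [← σ.apply_apply e₀]
      rw [← apply_mul, ← mul_assoc, hl]
  rw [← σ.apply_apply (c' * c), hg]

/-- If a division idempotent carries a nonzero symmetric form, every hyperbolic symmetric
idempotent has a symmetric square root of `d` in its corner. -/
theorem hasSymmSqrt_of_symm_ne_zero [FiniteDimensional F A] [IsSimpleRing A]
    (he₀ : IsDivisionIdempotent e₀) {c : A} (h0 : c ≠ 0) (h1 : e₀ * c = c) (hc : σ c = c) (d : F) :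
    ∀ e : A, e * e = e → e * σ e = 0 → σ e * e = 0 → σ.HasSymmSqrt d (e + σ e) := by
  have h2 : c * σ e₀ = c := by rw [← hc, ← apply_mul, h1]
  obtain ⟨c', hl, hr, hcc', hc'c⟩ := exists_inverse_of_ne_zero he₀ h0 h1 h2
  have hc' : σ c' = c' := by
    have h3 : σ c' * c = σ e₀ := by rw [← hcc', apply_mul, hc]
    have h4 : σ c' * e₀ = σ c' := by rw [← σ.apply_apply e₀, ← apply_mul, hl]
    rw [← h4, ← hcc', ← mul_assoc, h3, hl]
  suffices H : ∀ n, ∀ e : A, rightIdealRank F e < n → e * e = e → e * σ e = 0 → σ e * e = 0 →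
      σ.HasSymmSqrt d (e + σ e) from fun e => H _ e (Nat.lt_succ_self _)
  intro n
  induction n with
  | zero => intro e he; exact absurd he (Nat.not_lt_zero _)
  | succ n ih =>
    intro e hn he heσ hσe
    by_cases hz : e = 0
    · rw [hz, map_zero, add_zero]; exact HasSymmSqrt.zero d
    obtain ⟨v, w, hw, hv, hwv, hev, hwe⟩ := he₀.exists_factor he hz
    have hf : v * w * (v * w) = v * w := by
      rw [mul_assoc, ← mul_assoc w, hwv, ← mul_assoc, hv]
    have hef : e * (v * w) = v * w := by rw [← mul_assoc, hev]
    have hfe : v * w * e = v * w := by rw [mul_assoc, hwe]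
    obtain ⟨f, hfdef⟩ : ∃ f, f = v * w := ⟨_, rfl⟩
    have hrk : 0 < rightIdealRank F f := by
      refine rightIdealRank_pos F fun h => he₀.ne_zero ?_
      rw [← he₀.idem, ← hwv, mul_assoc, ← mul_assoc v, ← hfdef, h]; simp
    rw [← hfdef] at hf hef hfe
    have hσef : σ e * σ f = σ f := by rw [← apply_mul, hfe]
    have hσfe : σ f * σ e = σ f := by rw [← apply_mul, hef]
    have hfσe : f * σ e = 0 := by rw [← hfe, mul_assoc, heσ, mul_zero]
    have hσef0 : σ e * f = 0 := by rw [← hef, ← mul_assoc, hσe, zero_mul]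
    have heσf : e * σ f = 0 := by rw [← hσef, ← mul_assoc, heσ, zero_mul]
    have hσfe0 : σ f * e = 0 := by rw [← hσfe, mul_assoc, hσe, mul_zero]
    have hfσ : f * σ f = 0 := by rw [← hσef, ← mul_assoc, hfσe, zero_mul]
    have hσf : σ f * f = 0 := by rw [← hσfe, mul_assoc, hσef0, mul_zero]
    have hσff : σ f * σ f = σ f := by rw [← apply_mul, hf]
    -- The symmetric pair `c`, `c'` is transported from `e₀` to the equivalent idempotent `f`; the
    -- induction continues on `e - f`.
    have hgood : σ.HasSymmSqrt d (f + σ f) := by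
      refine hasSymmSqrt_of_pairing d (c := v * c * σ v) (c' := σ w * c' * w) hfσ hσf ?_ ?_ ?_ ?_ ?_
      · rw [hfdef, mul_assoc v w, mul_assoc v c, ← mul_assoc w, hwv, ← mul_assoc, ← mul_assoc,
          hv, mul_assoc]
      · simp only [apply_mul, apply_apply, hc, mul_assoc]
      · rw [hfdef, mul_assoc _ w, ← mul_assoc w, hwv, hw]
      · simp only [apply_mul, apply_apply, hc', mul_assoc]
      · have : σ v * σ w = σ e₀ := by rw [← apply_mul, hwv]
        calc v * c * σ v * (σ w * c' * w) = v * c * (σ v * σ w) * c' * w := by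
              simp only [mul_assoc]
          _ = v * (c * c') * w := by rw [this, mul_assoc v, h2]; simp only [mul_assoc]
          _ = f := by rw [hcc', hv, hfdef]
    have hidem : (e - f) * (e - f) = e - f := by
      simp only [sub_mul, mul_sub, he, hef, hfe, hf]; abel
    have hrest := ih (e - f) ?_ hidem ?_ ?_
    · have := hgood.add hrest ?_ ?_
      · convert this using 1
        rw [map_sub]; abel
      · simp only [map_sub, mul_add, add_mul, mul_sub, hfe, hf, hσfe0, hσf, hfσe, hfσ, hσfe, hσff]
        simp
      · simp only [map_sub, mul_add, add_mul, sub_mul, hef, hf, hσef0, hσf, heσf, hfσ, hσef, hσff]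
        simp
    · have := rightIdealRank_add F hf hidem (by rw [mul_sub, hfe, hf, sub_self])
        (by rw [sub_mul, hef, hf, sub_self])
      rw [add_sub_cancel] at this
      omega
    · simp only [map_sub, sub_mul, mul_sub, heσ, hfσe, heσf, hfσ]; simp
    · simp only [map_sub, sub_mul, mul_sub, hσe, hσfe0, hσef0, hσf]; simp

end LinInvolution

/-! ### Hyperbolic planes in the alternating case -/

namespace LinInvolution

section Ring

variable {F : Type u} {A : Type v} [CommRing F] [Ring A] [Algebra F A] {σ : LinInvolution F A}

/-- The idempotent `p` is of the form `e + σ e` with `e`, `σ e` orthogonal idempotents. -/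
def IsHyperbolicIdempotent (σ : LinInvolution F A) (p : A) : Prop :=
  ∃ e : A, e * e = e ∧ e * σ e = 0 ∧ σ e * e = 0 ∧ e + σ e = p

namespace IsHyperbolicIdempotent

variable {p q : A}

theorem zero (σ : LinInvolution F A) : σ.IsHyperbolicIdempotent 0 := ⟨0, by simp⟩

theorem symm (h : σ.IsHyperbolicIdempotent p) : σ p = p := by
  obtain ⟨e, -, -, -, rfl⟩ := h
  rw [map_add, apply_apply, add_comm]

theorem idem (h : σ.IsHyperbolicIdempotent p) : p * p = p := by
  obtain ⟨e, he, heσ, hσe, rfl⟩ := h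
  have hσ : σ e * σ e = σ e := by rw [← apply_mul, he]
  simp only [add_mul, mul_add, he, heσ, hσe, hσ, add_zero, zero_add]

theorem add (hp : σ.IsHyperbolicIdempotent p) (hq : σ.IsHyperbolicIdempotent q)
    (hpq : p * q = 0) (hqp : q * p = 0) : σ.IsHyperbolicIdempotent (p + q) := by
  have hpσ := hp.symm
  have hqσ := hq.symm
  obtain ⟨e, he, heσ, hσe, hep⟩ := hp
  obtain ⟨f, hf, hfσ, hσf, hfq⟩ := hq
  have h1 : e * p = e := by rw [← hep, mul_add, he, heσ, add_zero]
  have h2 : p * e = e := by rw [← hep, add_mul, he, hσe, add_zero]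
  have h3 : f * q = f := by rw [← hfq, mul_add, hf, hfσ, add_zero]
  have h4 : q * f = f := by rw [← hfq, add_mul, hf, hσf, add_zero]
  have h5 : p * σ e = σ e := by rw [← hpσ, ← apply_mul, h1]
  have h6 : σ e * p = σ e := by rw [← hpσ, ← apply_mul, h2]
  have h7 : q * σ f = σ f := by rw [← hqσ, ← apply_mul, h3]
  have h8 : σ f * q = σ f := by rw [← hqσ, ← apply_mul, h4]
  have key : ∀ {a b r s : A}, r * s = 0 → a * r = a → s * b = b → a * b = 0 := by
    intro a b r s h ha hb
    rw [← ha, ← hb, mul_assoc, ← mul_assoc r, h, zero_mul, mul_zero]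
  refine ⟨e + f, ?_, ?_, ?_, by rw [map_add, ← hep, ← hfq]; abel⟩
  · simp only [add_mul, mul_add, he, hf, key hpq h1 h4, key hqp h3 h2, add_zero, zero_add]
  · simp only [map_add, add_mul, mul_add, heσ, hfσ, key hpq h1 h7, key hqp h3 h5, add_zero]
  · simp only [map_add, add_mul, mul_add, hσe, hσf, key hpq h6 h4, key hqp h8 h2, add_zero]

end IsHyperbolicIdempotent

end Ring

variable {F : Type u} {A : Type v} [Field F] [Ring A] [Algebra F A] {σ : LinInvolution F A}
  {e₀ : A}

theorem exists_ne_zero_pairing [IsSimpleRing A] (σ : LinInvolution F A)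
    (he₀ : IsDivisionIdempotent e₀) : ∃ c, c ≠ 0 ∧ e₀ * c = c ∧ c * σ e₀ = c := by
  obtain ⟨a, ha⟩ : ∃ a, e₀ * a * σ e₀ ≠ 0 := by
    by_contra! h
    exact σ.apply_ne_zero he₀.ne_zero (eq_zero_of_forall_mul_mul_eq_zero he₀.ne_zero h)
  refine ⟨_, ha, by simp only [← mul_assoc, he₀.idem], ?_⟩
  rw [mul_assoc, ← apply_mul, he₀.idem]

/-- In the alternating case every nonzero symmetric idempotent dominates a hyperbolic plane. -/
theorem exists_hyperbolic_plane [FiniteDimensional F A] [IsSimpleRing A]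
    (he₀ : IsDivisionIdempotent e₀) (hskew : ∀ c, e₀ * c = c → σ c = c → c = 0) {p : A}
    (hp : p * p = p) (h0 : p ≠ 0) :
    ∃ v w, e₀ * w = w ∧ v * e₀ = v ∧ w * v = e₀ ∧ v * w * σ (v * w) = 0 ∧
      σ (v * w) * (v * w) = 0 ∧ p * v = v ∧ w * p = w ∧
      rightIdealRank F (v * w + σ (v * w)) = 2 * rightIdealRank F e₀ := by
  obtain ⟨v, w, hw, hv, hwv, hpv, hwp⟩ := he₀.exists_factor hp h0
  obtain ⟨c, hc0, h1, h2⟩ := exists_ne_zero_pairing σ he₀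
  obtain ⟨c', hl, hr, hcc', hc'c⟩ := exists_inverse_of_ne_zero he₀ hc0 h1 h2
  have hσ0 : σ e₀ * σ e₀ = σ e₀ := by rw [← apply_mul, he₀.idem]
  -- `w * σ w` is symmetric and lies in `e₀A`. For `σ v * v`, which does not, conjugation by `c`
  -- first moves it there.
  have hww : w * σ w = 0 :=
    hskew _ (by rw [← mul_assoc, hw]) (by rw [apply_mul, apply_apply])
  have hvv : σ v * v = 0 := by
    have h3 : c * (σ v * v) * σ c = 0 := by
      refine hskew _ (by rw [← mul_assoc, ← mul_assoc, h1]) ?_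
      simp only [apply_mul, apply_apply, mul_assoc]
    calc σ v * v = σ (v * e₀) * (v * e₀) := by rw [hv]
      _ = σ e₀ * (σ v * v) * e₀ := by rw [apply_mul]; simp only [mul_assoc]
      _ = c' * c * (σ v * v) * σ (c' * c) := by rw [hc'c, apply_apply]
      _ = c' * (c * (σ v * v) * σ c) * σ c' := by rw [apply_mul]; simp only [mul_assoc]
      _ = 0 := by rw [h3, mul_zero, zero_mul]
  have hf : v * w * (v * w) = v * w := by
    rw [mul_assoc, ← mul_assoc w, hwv, ← mul_assoc, hv]
  have hσf : σ (v * w) * σ (v * w) = σ (v * w) := by rw [← apply_mul, hf]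
  have hfσ : v * w * σ (v * w) = 0 := by
    rw [apply_mul, mul_assoc, ← mul_assoc w, hww, zero_mul, mul_zero]
  have hσff : σ (v * w) * (v * w) = 0 := by
    rw [apply_mul, mul_assoc, ← mul_assoc _ v, hvv, zero_mul, mul_zero]
  refine ⟨v, w, hw, hv, hwv, hfσ, hσff, hpv, hwp, ?_⟩
  have hr1 : rightIdealRank F (v * w) = rightIdealRank F e₀ := by
    rw [rightIdealRank_mul_comm F hf (by rw [hwv, he₀.idem]), hwv]
  have hr2 : rightIdealRank F (σ (v * w)) = rightIdealRank F e₀ := by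
    rw [apply_mul] at hσf ⊢
    rw [rightIdealRank_mul_comm F hσf (by rw [← apply_mul, hwv, hσ0]), ← apply_mul, hwv, ← hc'c,
      rightIdealRank_mul_comm F (by rw [hc'c, hσ0]) (by rw [hcc', he₀.idem]), hcc']
  rw [rightIdealRank_add F hf hσf hfσ hσff, hr1, hr2, two_mul]

/-- One plane admits no symmetric pairing, but crossing two planes does: place `c` in one
off-diagonal position and `σ c` in the opposite one, so that `σ` swaps the two summands. -/
theorem hasSymmSqrt_of_two_planes [IsSimpleRing A] (he₀ : IsDivisionIdempotent e₀) (d : F)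
    {v₁ w₁ v₂ w₂ : A} (hw₁ : e₀ * w₁ = w₁) (hv₁ : v₁ * e₀ = v₁) (hwv₁ : w₁ * v₁ = e₀)
    (hw₂ : e₀ * w₂ = w₂) (hv₂ : v₂ * e₀ = v₂) (hwv₂ : w₂ * v₂ = e₀) (h12 : w₁ * v₂ = 0)
    (h21 : w₂ * v₁ = 0)
    (heσ : (v₁ * w₁ + v₂ * w₂) * σ (v₁ * w₁ + v₂ * w₂) = 0)
    (hσe : σ (v₁ * w₁ + v₂ * w₂) * (v₁ * w₁ + v₂ * w₂) = 0) :
    σ.HasSymmSqrt d (v₁ * w₁ + v₂ * w₂ + σ (v₁ * w₁ + v₂ * w₂)) := by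
  obtain ⟨c, hc0, h1, h2⟩ := exists_ne_zero_pairing σ he₀
  obtain ⟨c', hl, hr, hcc', hc'c⟩ := exists_inverse_of_ne_zero he₀ hc0 h1 h2
  have hev₁ : (v₁ * w₁ + v₂ * w₂) * v₁ = v₁ := by
    rw [add_mul, mul_assoc, hwv₁, mul_assoc, h21, hv₁, mul_zero, add_zero]
  have hev₂ : (v₁ * w₁ + v₂ * w₂) * v₂ = v₂ := by
    rw [add_mul, mul_assoc, h12, mul_assoc, hwv₂, hv₂, mul_zero, zero_add]
  have hwe₁ : w₁ * (v₁ * w₁ + v₂ * w₂) = w₁ := by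
    rw [mul_add, ← mul_assoc, hwv₁, ← mul_assoc, h12, hw₁, zero_mul, add_zero]
  have hwe₂ : w₂ * (v₁ * w₁ + v₂ * w₂) = w₂ := by
    rw [mul_add, ← mul_assoc, h21, ← mul_assoc, hwv₂, hw₂, zero_mul, zero_add]
  refine hasSymmSqrt_of_pairing d (c := v₁ * c * σ v₂ + v₂ * σ c * σ v₁)
    (c' := σ w₂ * c' * w₁ + σ w₁ * σ c' * w₂) heσ hσe ?_ ?_ ?_ ?_ ?_
  · rw [mul_add]
    simp only [← mul_assoc]
    rw [hev₁, hev₂]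
  · simp only [map_add, apply_mul, apply_apply, mul_assoc]
    rw [add_comm]
  · rw [add_mul, mul_assoc _ w₁, mul_assoc _ w₂, hwe₁, hwe₂]
  · simp only [map_add, apply_mul, apply_apply, mul_assoc]
    rw [add_comm]
  · have k1 : σ v₂ * σ w₁ = 0 := by rw [← apply_mul, h12, map_zero]
    have k2 : σ v₁ * σ w₂ = 0 := by rw [← apply_mul, h21, map_zero]
    have k3 : σ v₂ * σ w₂ = σ e₀ := by rw [← apply_mul, hwv₂]
    have k4 : σ v₁ * σ w₁ = σ e₀ := by rw [← apply_mul, hwv₁]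
    calc (v₁ * c * σ v₂ + v₂ * σ c * σ v₁) * (σ w₂ * c' * w₁ + σ w₁ * σ c' * w₂)
        = v₁ * (c * (σ v₂ * σ w₂)) * c' * w₁ + v₁ * c * (σ v₂ * σ w₁) * σ c' * w₂
          + v₂ * σ c * (σ v₁ * σ w₂) * c' * w₁ + v₂ * σ c * ((σ v₁ * σ w₁) * σ c') * w₂ := by
          noncomm_ring
      _ = v₁ * (c * c') * w₁ + v₂ * σ (c' * c) * w₂ := by
          have h5 : σ e₀ * σ c' = σ c' := by rw [← apply_mul, hr]
          rw [k1, k2, k3, k4, h2, h5, apply_mul]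
          noncomm_ring
      _ = v₁ * w₁ + v₂ * w₂ := by rw [hcc', hc'c, apply_apply, hv₁, hv₂]

/-- In the alternating case, symmetric idempotents are hyperbolic, and their corners contain a
symmetric square root of `d` if they are orthogonal sums of an even number of planes. -/
theorem hyperbolic_of_alternating [FiniteDimensional F A] [IsSimpleRing A]
    (he₀ : IsDivisionIdempotent e₀) (hskew : ∀ c, e₀ * c = c → σ c = c → c = 0) (d : F) :
    ∀ p : A, p * p = p → σ p = p → σ.IsHyperbolicIdempotent p ∧
      ∃ k, rightIdealRank F p = 2 * k * rightIdealRank F e₀ ∧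
        (Even k → σ.HasSymmSqrt d p) := by
  suffices H : ∀ n, ∀ p : A, rightIdealRank F p < n → p * p = p → σ p = p →
      σ.IsHyperbolicIdempotent p ∧ ∃ k, rightIdealRank F p = 2 * k * rightIdealRank F e₀ ∧
        (Even k → σ.HasSymmSqrt d p) from fun p => H _ p (Nat.lt_succ_self _)
  have hpos := rightIdealRank_pos F he₀.ne_zero
  have hsub : ∀ {p f : A}, p * p = p → f * f = f → σ p = p → σ f = f → p * f = f →
      (p - f) * (p - f) = p - f ∧ σ (p - f) = p - f ∧ f * (p - f) = 0 ∧ (p - f) * f = 0 ∧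
      rightIdealRank F p = rightIdealRank F f + rightIdealRank F (p - f) := by
    intro p f hp hf hσp hσf hpf
    have hfp : f * p = f := by
      have := congrArg (fun z => σ z) hpf
      simpa only [apply_mul, hσp, hσf] using this
    have h1 : (p - f) * (p - f) = p - f := by
      simp only [sub_mul, mul_sub, hp, hpf, hfp, hf]; abel
    have h3 : f * (p - f) = 0 := by rw [mul_sub, hfp, hf, sub_self]
    have h4 : (p - f) * f = 0 := by rw [sub_mul, hpf, hf, sub_self]
    refine ⟨h1, by rw [map_sub, hσp, hσf], h3, h4, ?_⟩
    rw [← rightIdealRank_add F hf h1 h3 h4, add_sub_cancel]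
  have hplane : ∀ {p : A}, p * p = p → σ p = p → p ≠ 0 → ∃ v w, e₀ * w = w ∧ v * e₀ = v ∧
      w * v = e₀ ∧ v * w * σ (v * w) = 0 ∧ σ (v * w) * (v * w) = 0 ∧
      σ.IsHyperbolicIdempotent (v * w + σ (v * w)) ∧ p * v = v ∧ w * p = w ∧
      p * (v * w + σ (v * w)) = v * w + σ (v * w) ∧
      rightIdealRank F (v * w + σ (v * w)) = 2 * rightIdealRank F e₀ := by
    intro p hp hσp h0
    obtain ⟨v, w, hw, hv, hwv, heσ, hσe, hpv, hwp, hr⟩ := exists_hyperbolic_plane he₀ hskew hp h0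
    refine ⟨v, w, hw, hv, hwv, heσ, hσe, ⟨_, ?_, heσ, hσe, rfl⟩, hpv, hwp, ?_, hr⟩
    · rw [mul_assoc, ← mul_assoc w, hwv, ← mul_assoc, hv]
    · rw [mul_add, ← mul_assoc, hpv]
      nth_rw 1 [← hσp]
      rw [← apply_mul, mul_assoc, hwp]
  intro n
  induction n with
  | zero => intro p hp; exact absurd hp (Nat.not_lt_zero _)
  | succ n ih =>
    intro p hn hp hσp
    by_cases h0 : p = 0
    · subst h0
      refine ⟨.zero σ, 0, ?_, fun _ => .zero d⟩
      simp [rightIdealRank, LinearMap.mulLeft_zero_eq_zero]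
    obtain ⟨v₁, w₁, hw₁, hv₁, hwv₁, heσ₁, hσe₁, hf₁, -, -, hpf₁, hr₁⟩ := hplane hp hσp h0
    obtain ⟨f₁, hf₁def⟩ : ∃ f, f = v₁ * w₁ + σ (v₁ * w₁) := ⟨_, rfl⟩
    rw [← hf₁def] at hf₁ hpf₁ hr₁
    obtain ⟨hq, hσq, hfq, hqf, hrq⟩ := hsub hp hf₁.idem hσp hf₁.symm hpf₁
    obtain ⟨q, hqdef⟩ : ∃ q, q = p - f₁ := ⟨_, rfl⟩
    have hpq : p = f₁ + q := by rw [hqdef, add_sub_cancel]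
    rw [← hqdef] at hq hσq hfq hqf hrq
    by_cases hq0 : q = 0
    · rw [hq0, add_zero] at hpq
      rw [hpq]
      -- A single leftover plane has `k = 1`, so no square root is owed.
      exact ⟨hf₁, 1, by rw [hr₁], fun h => absurd h (by decide)⟩
    obtain ⟨v₂, w₂, hw₂, hv₂, hwv₂, heσ₂, hσe₂, hf₂, hqv₂, hwq₂, hqf₂, hr₂⟩ := hplane hq hσq hq0
    obtain ⟨f₂, hf₂def⟩ : ∃ f, f = v₂ * w₂ + σ (v₂ * w₂) := ⟨_, rfl⟩
    rw [← hf₂def] at hf₂ hqf₂ hr₂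
    obtain ⟨hs, hσs, hfs, hsf, hrs⟩ := hsub hq hf₂.idem hσq hf₂.symm hqf₂
    obtain ⟨s, hsdef⟩ : ∃ s, s = q - f₂ := ⟨_, rfl⟩
    have hqs : q = f₂ + s := by rw [hsdef, add_sub_cancel]
    rw [← hsdef] at hs hσs hfs hsf hrs
    obtain ⟨hhyp, k, hk, hsqrt⟩ := ih s (by omega) hs hσs
    have hf₂q : f₂ * q = f₂ := by rw [hqs, mul_add, hf₂.idem, hfs, add_zero]
    have hsq : s * q = s := by rw [hqs, mul_add, hsf, hs, zero_add]
    have hqs' : q * s = s := by rw [hqs, add_mul, hfs, hs, zero_add]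
    have hf₁f₂ : f₁ * f₂ = 0 := by rw [← hqf₂, ← mul_assoc, hfq, zero_mul]
    have hf₂f₁ : f₂ * f₁ = 0 := by rw [← hf₂q, mul_assoc, hqf, mul_zero]
    have hf₁s : f₁ * s = 0 := by rw [← hqs', ← mul_assoc, hfq, zero_mul]
    have hsf₁ : s * f₁ = 0 := by rw [← hsq, mul_assoc, hqf, mul_zero]
    have hp' : p = f₁ + f₂ + s := by rw [hpq, hqs, add_assoc]
    have ho1 : (f₁ + f₂) * s = 0 := by rw [add_mul, hf₁s, hfs, add_zero]
    have ho2 : s * (f₁ + f₂) = 0 := by rw [mul_add, hsf₁, hsf, add_zero]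
    -- Two planes are split off at once, so the parity of `k` is that of the remainder `s`.
    refine ⟨hp' ▸ (hf₁.add hf₂ hf₁f₂ hf₂f₁).add hhyp ho1 ho2, k + 2, ?_, fun hk2 => ?_⟩
    · rw [hrq, hr₁, hrs, hr₂, hk]; ring
    · have hf₁v₁ : f₁ * v₁ = v₁ := by
        have : v₁ * w₁ * v₁ = v₁ := by rw [mul_assoc, hwv₁, hv₁]
        rw [hf₁def, add_mul, this]
        nth_rw 3 [← this]
        rw [← mul_assoc, hσe₁, zero_mul, add_zero]
      have hw₁f₁ : w₁ * f₁ = w₁ := by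
        have : w₁ * (v₁ * w₁) = w₁ := by rw [← mul_assoc, hwv₁, hw₁]
        rw [hf₁def, mul_add, this]
        nth_rw 2 [← this]
        rw [mul_assoc w₁, heσ₁, mul_zero, add_zero]
      have hσw₁ : f₁ * σ w₁ = σ w₁ := by rw [← hf₁.symm, ← apply_mul, hw₁f₁]
      have hσv₁ : σ v₁ * f₁ = σ v₁ := by rw [← hf₁.symm, ← apply_mul, hf₁v₁]
      have hqσw₂ : q * σ w₂ = σ w₂ := by rw [← hσq, ← apply_mul, hwq₂]
      have hσv₂q : σ v₂ * q = σ v₂ := by rw [← hσq, ← apply_mul, hqv₂]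
      have orth : ∀ {a b r t : A}, r * t = 0 → a * r = a → t * b = b → a * b = 0 := by
        intro a b r t h ha hb
        rw [← ha, ← hb, mul_assoc, ← mul_assoc r, h, zero_mul, mul_zero]
      have h12 : w₁ * v₂ = 0 := orth hfq hw₁f₁ hqv₂
      have h21 : w₂ * v₁ = 0 := orth hqf hwq₂ hf₁v₁
      have heσ : (v₁ * w₁ + v₂ * w₂) * σ (v₁ * w₁ + v₂ * w₂) = 0 := by
        have a1 : v₁ * w₁ * σ (v₂ * w₂) = 0 := by
          rw [apply_mul, mul_assoc, ← mul_assoc w₁, orth hfq hw₁f₁ hqσw₂, zero_mul, mul_zero]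
        have a2 : v₂ * w₂ * σ (v₁ * w₁) = 0 := by
          rw [apply_mul, mul_assoc, ← mul_assoc w₂, orth hqf hwq₂ hσw₁, zero_mul, mul_zero]
        rw [map_add, add_mul, mul_add, mul_add, heσ₁, heσ₂, a1, a2]; simp
      have hσe : σ (v₁ * w₁ + v₂ * w₂) * (v₁ * w₁ + v₂ * w₂) = 0 := by
        have a1 : σ (v₁ * w₁) * (v₂ * w₂) = 0 := by
          rw [apply_mul, mul_assoc, ← mul_assoc _ v₂, orth hfq hσv₁ hqv₂, zero_mul, mul_zero]
        have a2 : σ (v₂ * w₂) * (v₁ * w₁) = 0 := by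
          rw [apply_mul, mul_assoc, ← mul_assoc _ v₁, orth hqf hσv₂q hf₁v₁, zero_mul, mul_zero]
        rw [map_add, add_mul, mul_add, mul_add, hσe₁, hσe₂, a1, a2]; simp
      have hpair := hasSymmSqrt_of_two_planes (σ := σ) he₀ d hw₁ hv₁ hwv₁ hw₂ hv₂ hwv₂ h12 h21
        heσ hσe
      have heq : v₁ * w₁ + v₂ * w₂ + σ (v₁ * w₁ + v₂ * w₂) = f₁ + f₂ := by
        rw [hf₁def, hf₂def, map_add]; abel
      rw [heq] at hpair
      rw [hp']
      exact hpair.add (hsqrt (by simpa [Nat.even_add] using hk2)) ho1 ho2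

end LinInvolution

/-! ### Quadratic extensions and hyperbolicity of the tensor product -/

/-- A quadratic extension of characteristic not two is generated by a square root which the
nontrivial automorphism negates. -/
theorem exists_quadratic_generator {F : Type u} {K : Type w} [Field F] (h2 : (2 : F) ≠ 0)
    [Field K] [Algebra F K] (hK : Module.finrank F K = 2) (ι : K ≃ₐ[F] K)
    (hι : ι ≠ AlgEquiv.refl) :
    ∃ (α : K) (d : F) (π₀ π₁ : K →ₗ[F] F), d ≠ 0 ∧ α * α = algebraMap F K d ∧ ι α = -α ∧
      (∀ k, k = π₀ k • 1 + π₁ k • α) ∧ π₀ 1 = 1 ∧ π₀ α = 0 ∧ π₁ 1 = 0 ∧ π₁ α = 1 := by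
  obtain ⟨β, hβ⟩ : ∃ β, ι β ≠ β := by
    by_contra! h
    exact hι (AlgEquiv.ext h)
  obtain ⟨α, hα⟩ : ∃ α, α = β - ι β := ⟨_, rfl⟩
  have hα0 : α ≠ 0 := by rw [hα]; exact sub_ne_zero.2 hβ.symm
  have hια : ι α = -α := by
    rw [hα, map_sub, LinInvolution.quadratic_apply_apply hK]; ring
  have h2K : (2 : K) ≠ 0 := by
    rw [← map_ofNat (algebraMap F K) 2]
    exact (map_ne_zero _).2 h2
  have hneg : ∀ z : K, z = -z → z = 0 := fun z hz => by
    have : 2 * z = 0 := by linear_combination hz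
    exact (mul_eq_zero.1 this).resolve_left h2K
  have hli : LinearIndependent F ![1, α] := by
    rw [linearIndependent_fin2]
    refine ⟨hα0, fun a ha => ?_⟩
    simp only [Matrix.cons_val_one, Matrix.cons_val_zero] at ha
    have h := congrArg ι ha
    rw [map_smul, hια, map_one, smul_neg, ha] at h
    exact one_ne_zero (hneg 1 h.symm)
  let B := basisOfLinearIndependentOfCardEqFinrank hli (by rw [hK]; rfl)
  have hB0 : B 0 = 1 := by simp [B]
  have hB1 : B 1 = α := by simp [B]
  have hdec : ∀ k, k = B.coord 0 k • 1 + B.coord 1 k • α := fun k => by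
    conv_lhs => rw [← B.sum_repr k]
    rw [Fin.sum_univ_two, hB0, hB1]
    rfl
  -- `α²` is fixed by `ι`, so its `α`-coordinate equals its own negative.
  have hαα : α * α = algebraMap F K (B.coord 0 (α * α)) := by
    have h := hdec (α * α)
    have h' := congrArg ι h
    rw [map_mul, hια, neg_mul_neg, map_add, map_smul, map_smul, hια, map_one] at h'
    have h3 : B.coord 1 (α * α) • α = 0 :=
      hneg _ (by rw [← smul_neg]; exact add_left_cancel (h.symm.trans h'))
    rw [h3, add_zero] at h
    rwa [Algebra.algebraMap_eq_smul_one]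
  refine ⟨α, _, B.coord 0, B.coord 1, ?_, hαα, hια, hdec, ?_, ?_, ?_, ?_⟩
  · intro h
    rw [h, map_zero] at hαα
    exact hα0 (mul_self_eq_zero.1 hαα)
  all_goals simp [← hB0, ← hB1]

namespace LinInvolution

section Quadratic

variable {F : Type u} {K : Type w} {A : Type v} [Field F] [Field K] [Algebra F K]
  [Ring A] [Algebra F A] {σ : LinInvolution F A} {α : K} {d : F} {π₀ π₁ : K →ₗ[F] F}

/-- A symmetric square root of `d` in `A` gives an embedding of `F(√d)` with trivial involution. -/
theorem embeds_of_hasSymmSqrt_one [Nontrivial A] (hα : α * α = algebraMap F K d)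
    (hdec : ∀ k, k = π₀ k • 1 + π₁ k • α) (h01 : π₀ 1 = 1) (h0α : π₀ α = 0) (h11 : π₁ 1 = 0)
    (h1α : π₁ α = 1) (h : σ.HasSymmSqrt d 1) : (identity F K).Embeds σ := by
  obtain ⟨s, hs, hss, -, -⟩ := h
  have hmul : ∀ k l, k * l = (π₀ k * π₀ l + d * (π₁ k * π₁ l)) • 1 +
      (π₀ k * π₁ l + π₁ k * π₀ l) • α := fun k l => by
    conv_lhs => rw [hdec k, hdec l]
    simp only [Algebra.smul_def, map_add, map_mul]
    linear_combination (algebraMap F K (π₁ k) * algebraMap F K (π₁ l)) * hα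
  have hmul0 : ∀ k l, π₀ (k * l) = π₀ k * π₀ l + d * (π₁ k * π₁ l) := fun k l => by
    rw [hmul, map_add, map_smul, map_smul, h01, h0α]; simp
  have hmul1 : ∀ k l, π₁ (k * l) = π₀ k * π₁ l + π₁ k * π₀ l := fun k l => by
    rw [hmul, map_add, map_smul, map_smul, h11, h1α]; simp
  let f : K →ₐ[F] A := AlgHom.ofLinearMap
    (π₀.smulRight (1 : A) + π₁.smulRight s) (by simp [h01, h11]) (fun k l => by
      simp only [LinearMap.add_apply, LinearMap.smulRight_apply, hmul0, hmul1, add_mul, mul_add,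
        smul_mul_smul_comm, one_mul, mul_one, hss, add_smul, smul_smul]
      rw [show d * (π₁ k * π₁ l) = π₁ k * π₁ l * d by ring]
      abel)
  have hf : ∀ k, f k = π₀ k • 1 + π₁ k • s := fun _ => rfl
  refine ⟨f, f.toRingHom.injective, fun k => ?_⟩
  change f k = σ (f k)
  rw [hf, map_add, map_smul, map_smul, hs, apply_one]

theorem isHyperbolic_tensor_of_embeds (h2 : (2 : F) ≠ 0) (hK : Module.finrank F K = 2)
    {ι : K ≃ₐ[F] K} (hd : d ≠ 0) (hα : α * α = algebraMap F K d) (hια : ι α = -α)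
    (h : (identity F K).Embeds σ) : (σ.tensor (ofQuadratic hK ι)).IsHyperbolic := by
  obtain ⟨f, -, hf⟩ := h
  have hs : σ (f α) = f α := (hf α).symm
  have hss : f α * f α = d • 1 := by
    rw [← map_mul, hα, AlgHom.commutes, Algebra.algebraMap_eq_smul_one]
  obtain ⟨r, hr⟩ : ∃ r : F, r + r = 1 := ⟨2⁻¹, by rw [← two_mul, mul_inv_cancel₀ h2]⟩
  obtain ⟨q, hq⟩ : ∃ q : F, q * d = r := ⟨r / d, div_mul_cancel₀ r hd⟩
  -- Here `r = 1/2` and `q = 1/(2d)`: the element `d⁻¹ f(α) ⊗ α` is skew of square `1`, and `e` is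
  -- half of one plus it.
  refine ⟨r • 1 + q • (f α ⊗ₜ[F] α), ?_, ?_⟩
  · have h1 : (f α ⊗ₜ[F] α) * (f α ⊗ₜ[F] α) = (d * d) • (1 : A ⊗[F] K) := by
      rw [Algebra.TensorProduct.tmul_mul_tmul, hss, hα, Algebra.algebraMap_eq_smul_one,
        TensorProduct.smul_tmul_smul, Algebra.TensorProduct.one_def]
    have e1 : r * r + q * q * (d * d) = r := by
      rw [show q * q * (d * d) = (q * d) * (q * d) by ring, hq]
      linear_combination r * hr
    have e2 : r * q + q * r = q := by linear_combination q * hr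
    calc _ = (r * r + q * q * (d * d)) • (1 : A ⊗[F] K) + (r * q + q * r) • (f α ⊗ₜ[F] α) := by
          simp only [add_mul, mul_add, smul_mul_smul_comm, one_mul, mul_one, h1, smul_smul,
            add_smul]
          abel
      _ = _ := by rw [e1, e2]
  · have h1 : (σ.tensor (ofQuadratic hK ι)) (f α ⊗ₜ[F] α) = -(f α ⊗ₜ[F] α) := by
      change σ (f α) ⊗ₜ[F] ι α = _
      rw [hs, hια, TensorProduct.tmul_neg]
    rw [map_add, map_smul, map_smul, h1, apply_one, smul_neg]
    have : (1 : A ⊗[F] K) = r • 1 + r • 1 := by rw [← add_smul, hr, one_smul]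
    rw [sub_add_eq_sub_sub, sub_eq_of_eq_add this, sub_eq_add_neg]

theorem exists_anticommuting_of_isHyperbolic_tensor (hK : Module.finrank F K = 2)
    {ι : K ≃ₐ[F] K} (hα : α * α = algebraMap F K d) (hια : ι α = -α)
    (hdec : ∀ k, k = π₀ k • 1 + π₁ k • α) (h01 : π₀ 1 = 1) (h0α : π₀ α = 0) (h11 : π₁ 1 = 0)
    (h1α : π₁ α = 1) (h : (σ.tensor (ofQuadratic hK ι)).IsHyperbolic) :
    ∃ x y : A, σ x = -x ∧ σ y = y ∧ x * x + d • (y * y) = 1 ∧ y * x = -x * y := by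
  obtain ⟨e, he, hσe⟩ := h
  obtain ⟨a, c, rfl⟩ : ∃ a c : A, e = a ⊗ₜ[F] (1 : K) + c ⊗ₜ[F] α := by
    clear he hσe
    induction e with
    | zero => exact ⟨0, 0, by simp⟩
    | add e e' h h' =>
      obtain ⟨a, c, rfl⟩ := h
      obtain ⟨a', c', rfl⟩ := h'
      exact ⟨a + a', c + c', by rw [TensorProduct.add_tmul, TensorProduct.add_tmul]; abel⟩
    | tmul a k =>
      refine ⟨π₀ k • a, π₁ k • a, ?_⟩
      conv_lhs => rw [hdec k]
      rw [TensorProduct.tmul_add, TensorProduct.tmul_smul, TensorProduct.tmul_smul,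
        TensorProduct.smul_tmul', TensorProduct.smul_tmul']
  have huniq : ∀ {a c a' c' : A}, a ⊗ₜ[F] (1 : K) + c ⊗ₜ[F] α = a' ⊗ₜ[F] (1 : K) + c' ⊗ₜ[F] α →
      a = a' ∧ c = c' := by
    intro a c a' c' h
    constructor
    · have := congrArg ((TensorProduct.rid F A).toLinearMap ∘ₗ π₀.lTensor A) h
      simpa [h01, h0α] using this
    · have := congrArg ((TensorProduct.rid F A).toLinearMap ∘ₗ π₁.lTensor A) h
      simpa [h11, h1α] using this
  have hτ : (σ.tensor (ofQuadratic hK ι)) (a ⊗ₜ[F] (1 : K) + c ⊗ₜ[F] α) =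
      σ a ⊗ₜ[F] (1 : K) + (-σ c) ⊗ₜ[F] α := by
    rw [map_add]
    change σ a ⊗ₜ[F] ι 1 + σ c ⊗ₜ[F] ι α = _
    rw [hια, map_one, TensorProduct.tmul_neg, TensorProduct.neg_tmul]
  obtain ⟨ha, hc⟩ := huniq (a := σ a) (c := -σ c) (a' := 1 - a) (c' := -c) (by
    rw [← hτ, hσe, TensorProduct.sub_tmul, TensorProduct.neg_tmul,
      Algebra.TensorProduct.one_def]
    abel)
  obtain ⟨hac, hca⟩ := huniq (a := a * a + d • (c * c)) (c := a * c + c * a) (a' := a) (c' := c) (by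
    refine Eq.trans ?_ he
    simp only [add_mul, mul_add, Algebra.TensorProduct.tmul_mul_tmul, one_mul, mul_one, hα,
      TensorProduct.add_tmul, Algebra.algebraMap_eq_smul_one, TensorProduct.tmul_smul,
      TensorProduct.smul_tmul']
    abel)
  rw [neg_inj] at hc
  have hac' : a * a = a - d • (c * c) := eq_sub_of_add_eq hac
  have hca' : c * a = c - a * c := eq_sub_of_add_eq' hca
  -- The involution `2e - 1` is `x ⊗ 1 + y ⊗ α`; being skew of square `1`, it gives the four
  -- relations by comparing coordinates.
  refine ⟨a + a - 1, c + c, ?_, by rw [map_add, hc], ?_, ?_⟩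
  · rw [map_sub, map_add, ha, apply_one]; abel
  · simp only [add_mul, mul_add, sub_mul, mul_sub, hac', one_mul, mul_one, smul_add]; abel
  · simp only [add_mul, mul_add, sub_mul, mul_sub, neg_sub, hca', one_mul,
      mul_one]
    abel

end Quadratic

end LinInvolution

/-! ### Obstruction to an embedding: dimension divisible by four -/

theorem even_finrank_of_skew_nondegenerate {K : Type u} {V : Type v} [Field K] (h2 : (2 : K) ≠ 0)
    [AddCommGroup V] [Module K V] [FiniteDimensional K V] (h : LinearMap.BilinForm K V)
    (hh : h.Nondegenerate) (hskew : ∀ x y, h x y = -h y x) : Even (Module.finrank K V) := by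
  let B := Module.finBasis K V
  have hdet := (LinearMap.BilinForm.nondegenerate_iff_det_ne_zero B).1 hh
  set M := LinearMap.BilinForm.toMatrix B h
  have hM : M.transpose = -M := by
    ext i j
    simp only [M, Matrix.transpose_apply, Matrix.neg_apply, LinearMap.BilinForm.toMatrix_apply]
    exact hskew _ _
  by_contra hodd
  rw [Nat.not_even_iff_odd] at hodd
  have h1 : M.det = -M.det := by
    conv_lhs => rw [← Matrix.det_transpose, hM, Matrix.det_neg, Fintype.card_fin, hodd.neg_one_pow]
    ring
  refine hdet ((mul_eq_zero.1 (?_ : 2 * M.det = 0)).resolve_left h2)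
  linear_combination h1

/-- A nondegenerate alternating form for which a quadratic extension acts by selfadjoint
endomorphisms lives on a space of dimension divisible by four. -/
theorem four_dvd_finrank_of_selfadjoint_quadratic {F : Type u} {K : Type w} {V : Type v} [Field F]
    [Field K] [Algebra F K] (h2 : (2 : F) ≠ 0) (hK : Module.finrank F K = 2)
    {α : K} {d : F} {π₀ π₁ : K →ₗ[F] F} (hα : α * α = algebraMap F K d)
    (hdec : ∀ k, k = π₀ k • 1 + π₁ k • α) (h11 : π₁ 1 = 0) (h1α : π₁ α = 1)
    [AddCommGroup V] [Module F V] [FiniteDimensional F V] (b : LinearMap.BilinForm F V)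
    (hb : b.Nondegenerate) (halt : b.IsAlt) (f : K →ₐ[F] Module.End F V)
    (hf : ∀ k x y, b x (f k y) = b (f k x) y) : 4 ∣ Module.finrank F V := by
  have h2K : (2 : K) ≠ 0 := by
    rw [← map_ofNat (algebraMap F K) 2]
    exact (map_ne_zero _).2 h2
  have hneg : ∀ x y, b x y = -b y x := fun x y => (LinearMap.IsAlt.neg halt y x).symm
  let : Module K V := Module.compHom V f.toRingHom
  have hsmul : ∀ (k : K) (x : V), k • x = f k x := fun _ _ => rfl
  have : IsScalarTower F K V := ⟨fun r k x => by
    rw [hsmul, hsmul, map_smul, LinearMap.smul_apply]⟩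
  have : FiniteDimensional K V := Module.Finite.of_restrictScalars_finite F K V
  have hfk : ∀ k x, k • x = π₀ k • x + π₁ k • f α x := fun k x => by
    rw [hsmul]
    conv_lhs => rw [hdec k]
    simp
  have hff : ∀ x, f α (f α x) = d • x := fun x => by
    rw [← Module.End.mul_apply, ← map_mul, hα, AlgHom.commutes, Module.algebraMap_end_apply]
  have hsplit : ∀ k z : K, k • z = algebraMap F K (π₀ k) * z + algebraMap F K (π₁ k) * α * z :=
    fun k z => by
      rw [smul_eq_mul]
      conv_lhs => rw [hdec k]
      simp only [Algebra.smul_def]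
      ring
  -- The `K`-bilinear form whose `α`-coordinate is `b`. Self-adjointness of `α` makes it skew, and
  -- it inherits nondegeneracy from its `α`-coordinate.
  let h : LinearMap.BilinForm K V := LinearMap.mk₂ K
    (fun x y => algebraMap F K (b x (f α y)) + algebraMap F K (b x y) * α)
    (fun x x' y => by simp; ring)
    (fun k x y => by
      rw [hsplit, hfk]
      simp only [map_add, LinearMap.add_apply, map_smul, LinearMap.smul_apply, smul_eq_mul,
        ← hf, hff, map_mul]
      linear_combination -(algebraMap F K (π₁ k) * algebraMap F K (b x y)) * hα)
    (fun x y y' => by simp; ring)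
    (fun k x y => by
      rw [hsplit, hfk]
      simp only [map_add, map_smul, smul_eq_mul, hff, map_mul]
      linear_combination -(algebraMap F K (π₁ k) * algebraMap F K (b x y)) * hα)
  have hh : ∀ x y, h x y = algebraMap F K (b x (f α y)) + algebraMap F K (b x y) * α :=
    fun _ _ => rfl
  have hskew : ∀ x y, h x y = -h y x := fun x y => by
    rw [hh, hh, hf, hneg, hneg x y, map_neg, map_neg]; ring
  have hzero : ∀ x y, h x y = 0 → b x y = 0 := fun x y hxy => by
    rw [hh, ← Algebra.smul_def, Algebra.algebraMap_eq_smul_one] at hxy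
    have := congrArg π₁ hxy
    simpa [h11, h1α] using this
  have hnd : h.Nondegenerate :=
    ⟨fun x hx => hb.1 x fun y => hzero _ _ (hx y), fun x hx => hb.2 x fun y => hzero _ _ (hx y)⟩
  obtain ⟨m, hm⟩ := even_finrank_of_skew_nondegenerate h2K h hnd hskew
  refine ⟨m, ?_⟩
  rw [← Module.finrank_mul_finrank F K V, hK, hm]
  ring

section

variable {F : Type u} {V : Type v} [Field F] [AddCommGroup V] [Module F V]

theorem exists_end_apply_eq {u : V} (hu : u ≠ 0) (z : V) : ∃ T : Module.End F V, T u = z := by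
  obtain ⟨f, hf⟩ : ∃ f : Module.Dual F V, f u ≠ 0 := by
    by_contra! h
    exact hu ((Module.forall_dual_apply_eq_zero_iff F u).1 h)
  exact ⟨f.smulRight ((f u)⁻¹ • z), by simp [smul_smul, mul_inv_cancel₀ hf]⟩

end

/-! ### Alternating corners and symplectic involutions -/

namespace LinInvolution

section

variable {F : Type u} {A : Type v} [Field F] [Ring A] [Algebra F A] {σ : LinInvolution F A}
  {e₀ : A}

/-- The hypothesis kills every `e₀(a + σ a)σ(e₀)`, a linear condition that survives base change. It
says that the adjoint form is skew against vectors in the image of `σ e₀`; one nonzero such vector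
suffices, since `End V` moves it anywhere. -/
theorem isSymplectic_of_alternating (h2 : (2 : F) ≠ 0) (he₀ : e₀ * e₀ = e₀) (h0 : e₀ ≠ 0)
    (halt : ∀ c, e₀ * c = c → σ c = c → c = 0) : σ.IsSymplectic := by
  intro L _ _ V _ _ _ φ b hb hadj
  have h2L : (2 : L) ≠ 0 := by
    rw [← map_ofNat (algebraMap F L) 2]
    exact (map_ne_zero _).2 h2
  obtain ⟨τ, hτ⟩ : ∃ τ, τ = σ.toLinearMap.baseChange L := ⟨_, rfl⟩
  rw [← hτ] at hadj
  have hττ : ∀ a, τ (τ a) = a := fun a => by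
    induction a with
    | zero => simp
    | add x y hx hy => rw [map_add, map_add, hx, hy]
    | tmul l a => rw [hτ, LinearMap.baseChange_tmul, LinearMap.baseChange_tmul, apply_apply]
  have key : ∀ a, ((1 : L) ⊗ₜ[F] e₀) * (a + τ a) * ((1 : L) ⊗ₜ[F] σ e₀) = 0 := fun a => by
    induction a with
    | zero => simp
    | add x y hx hy =>
      rw [map_add, add_add_add_comm, mul_add, add_mul, hx, hy, add_zero]
    | tmul l a =>
      rw [hτ, LinearMap.baseChange_tmul, ← TensorProduct.tmul_add,
        Algebra.TensorProduct.tmul_mul_tmul, Algebra.TensorProduct.tmul_mul_tmul]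
      rw [halt (e₀ * (a + σ a) * σ e₀), TensorProduct.tmul_zero]
      · simp only [← mul_assoc, he₀]
      · simp only [apply_mul, map_add, apply_apply, mul_assoc]
        rw [add_comm]
  have hS : φ ((1 : L) ⊗ₜ[F] σ e₀) ≠ 0 := by
    rw [Ne, map_eq_zero_iff φ φ.injective]
    intro h
    refine σ.apply_ne_zero h0 (Algebra.TensorProduct.includeRight_injective (A := L)
      (algebraMap F L).injective ?_)
    rw [Algebra.TensorProduct.includeRight_apply, h, map_zero]
  obtain ⟨x₀, hx₀⟩ : ∃ x₀, φ ((1 : L) ⊗ₜ[F] σ e₀) x₀ ≠ 0 := by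
    by_contra! h
    exact hS (LinearMap.ext h)
  obtain ⟨x, hx⟩ : ∃ x, x = φ ((1 : L) ⊗ₜ[F] σ e₀) x₀ := ⟨_, rfl⟩
  rw [← hx] at hx₀
  have hτE : τ ((1 : L) ⊗ₜ[F] e₀) = (1 : L) ⊗ₜ[F] σ e₀ := by
    rw [hτ, LinearMap.baseChange_tmul]
  have hbx : ∀ z, b x z = -b z x := fun z => by
    obtain ⟨T, rfl⟩ := exists_end_apply_eq (F := L) hx₀ z
    obtain ⟨a, rfl⟩ := φ.surjective T
    have h : b x₀ (φ (((1 : L) ⊗ₜ[F] e₀) * (a + τ a) * ((1 : L) ⊗ₜ[F] σ e₀)) x₀) = 0 := by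
      rw [key]; simp
    rw [map_mul, map_mul, Module.End.mul_apply, Module.End.mul_apply, ← hx, hadj, hτE, ← hx,
      map_add, LinearMap.add_apply, map_add, hadj (τ a), hττ] at h
    exact eq_neg_of_add_eq_zero_left h
  have hskew : ∀ z y, b z y = -b y z := fun z y => by
    obtain ⟨T, rfl⟩ := exists_end_apply_eq (F := L) hx₀ y
    obtain ⟨a, rfl⟩ := φ.surjective T
    rw [hadj, ← neg_neg (b _ x), ← hbx, hadj, hττ]
  intro z
  have h := hskew z z
  refine (mul_eq_zero.1 (?_ : 2 * b z z = 0)).resolve_left h2L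
  linear_combination h

/-- Every involution of `End V` is adjoint to a nondegenerate bilinear form. -/
theorem exists_adjoint_form {V : Type w} [AddCommGroup V] [Module F V] [FiniteDimensional F V]
    (σ : LinInvolution F A) (Φ : A ≃ₐ[F] Module.End F V) :
    ∃ b : LinearMap.BilinForm F V, b.Nondegenerate ∧
      ∀ a x y, b x (Φ a y) = b (Φ (σ a) x) y := by
  let g : Module.End F V →ₗ[F] Module.End F (Module.Dual F V) :=
    Module.Dual.transpose ∘ₗ Φ.toLinearMap ∘ₗ σ.toLinearMap ∘ₗ Φ.symm.toLinearMap
  have hg : ∀ T ξ x, g T ξ x = ξ (Φ (σ (Φ.symm T)) x) := fun _ _ _ => rfl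
  have hinj : Function.Injective g := by
    refine (injective_iff_map_eq_zero g).2 fun T hT => ?_
    have h1 : Φ (σ (Φ.symm T)) = 0 := by
      ext x
      refine (Module.forall_dual_apply_eq_zero_iff F _).1 fun ξ => ?_
      rw [← hg, hT]; rfl
    rw [map_eq_zero_iff Φ Φ.injective] at h1
    by_contra h
    exact σ.apply_ne_zero ((map_ne_zero_iff _ Φ.symm.injective).2 h) h1
  have hfin : Module.finrank F (Module.End F V) =
      Module.finrank F (Module.End F (Module.Dual F V)) := by
    rw [Module.finrank_linearMap F F V V,
      Module.finrank_linearMap F F (Module.Dual F V) (Module.Dual F V), Subspace.dual_finrank_eq]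
  have hsurj : Function.Surjective g :=
    (LinearMap.injective_iff_surjective_of_finrank_eq_finrank (K := F) (V := Module.End F V)
      (V₂ := Module.End F (Module.Dual F V)) hfin (f := g)).1 hinj
  let G : Module.End F V ≃ₐ[F] Module.End F (Module.Dual F V) :=
    AlgEquiv.ofBijective (AlgHom.ofLinearMap g (by ext; simp [hg, apply_one])
      (fun S T => by ext; simp [hg, apply_mul])) ⟨hinj, hsurj⟩
  -- `σ` followed by transposition is an isomorphism `End V ≃ End V*`, hence conjugation by some `T
  -- : V ≃ V*`. This `T` is the desired form.
  obtain ⟨T, hT⟩ := AlgEquiv.eq_linearEquivConjAlgEquiv G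
  have hT' : ∀ a x y, T (Φ a y) x = T y (Φ (σ a) x) := fun a x y => by
    have h1 : G (Φ a) (T y) x = T y (Φ (σ a) x) := by
      change g (Φ a) (T y) x = _
      rw [hg, AlgEquiv.symm_apply_apply]
    rw [← h1, hT, LinearEquiv.conjAlgEquiv_apply]
    simp
  refine ⟨T.toLinearMap.flip, ⟨fun x hx => ?_, fun y hy => ?_⟩, fun a x y => hT' a x y⟩
  · refine (Module.forall_dual_apply_eq_zero_iff F _).1 fun ξ => ?_
    have := hx (T.symm ξ)
    simpa using this
  · refine (map_eq_zero_iff T T.injective).1 (LinearMap.ext fun x => ?_)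
    exact hy x

theorem IsSymplectic.isAlt (hσ : σ.IsSymplectic) {V : Type u} [AddCommGroup V] [Module F V]
    [FiniteDimensional F V] (Φ : A ≃ₐ[F] Module.End F V) {b : LinearMap.BilinForm F V}
    (hb : b.Nondegenerate) (hadj : ∀ a x y, b x (Φ a y) = b (Φ (σ a) x) y) : b.IsAlt := by
  refine hσ F V ((Algebra.TensorProduct.lid F A).trans Φ) b hb fun a x y => ?_
  induction a with
  | zero => simp
  | add a a' h h' => simp only [map_add, LinearMap.add_apply, h, h']
  | tmul r a => simp [hadj]

/-- Rank one corners of a split algebra with symplectic involution are alternating. -/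
theorem alternating_of_isAlt (h2 : (2 : F) ≠ 0) {n : ℕ}
    (ψ : A ≃ₐ[F] Matrix (Fin n) (Fin n) F) (i : Fin n) {b : LinearMap.BilinForm F (Fin n → F)}
    (hb : b.Nondegenerate) (halt : b.IsAlt)
    (hadj : ∀ a x y, b x (Matrix.toLinAlgEquiv' (ψ a) y) =
      b (Matrix.toLinAlgEquiv' (ψ (σ a)) x) y) {c : A}
    (hc : ψ.symm (Matrix.single i i 1) * c = c) (hσc : σ c = c) : c = 0 := by
  obtain ⟨T, hT⟩ : ∃ T, T = Matrix.toLinAlgEquiv' (ψ c) := ⟨_, rfl⟩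
  have hTi : ∀ x, T x = T x i • Pi.single i 1 := fun x => by
    have : T x = (Matrix.single i i 1).mulVec (T x) := by
      have h := congrArg (fun a => Matrix.toLinAlgEquiv' (ψ a) x) hc
      simp only [map_mul, AlgEquiv.apply_symm_apply, Module.End.mul_apply, ← hT] at h
      rw [← h]
      simp
    conv_lhs => rw [this]
    ext j
    rw [Matrix.single_mulVec]
    simp [Function.update_apply, Pi.single_apply]
  -- `T` is self-adjoint for an alternating form, so `b x (T x) = 0`. A product of two linear
  -- functionals vanishes identically only if one of them does, and nondegeneracy excludes the
  -- second.
  have hbT : ∀ x, T x i * b x (Pi.single i 1) = 0 := fun x => by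
    have h1 : b x (T x) = 0 := by
      have h := hadj c x x
      rw [hσc, ← hT] at h
      refine (mul_eq_zero.1 (?_ : 2 * b x (T x) = 0)).resolve_left h2
      have h' := LinearMap.IsAlt.neg halt (T x) x
      linear_combination h - h'
    rw [hTi, map_smul, smul_eq_mul] at h1
    exact h1
  have hT0 : T = 0 := by
    by_contra hne
    obtain ⟨x, hx⟩ : ∃ x, T x i ≠ 0 := by
      by_contra! h
      exact hne (LinearMap.ext fun x => by rw [hTi, h, zero_smul, LinearMap.zero_apply])
    have hbx : b x (Pi.single i 1) = 0 := (mul_eq_zero.1 (hbT x)).resolve_left hx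
    obtain ⟨y, hy⟩ : ∃ y, b y (Pi.single i 1) ≠ 0 := by
      by_contra! h
      have := congrFun (hb.2 _ h) i
      simp at this
    have hTy : T y i = 0 := (mul_eq_zero.1 (hbT y)).resolve_right hy
    have := hbT (x + y)
    rw [map_add, map_add, LinearMap.add_apply, hbx, zero_add, Pi.add_apply, hTy, add_zero] at this
    exact (mul_ne_zero hx hy) this
  rw [hT, map_eq_zero_iff _ (AlgEquiv.injective _), map_eq_zero_iff _ ψ.injective] at hT0
  exact hT0

/-- The division ring at an alternating division idempotent is commutative. -/
theorem commute_of_alternating [IsSimpleRing A] (he₀ : IsDivisionIdempotent e₀)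
    (halt : ∀ c, e₀ * c = c → σ c = c → c = 0) {a b : A} (ha : e₀ * a = a) (ha' : a * e₀ = a)
    (hb : e₀ * b = b) (hb' : b * e₀ = b) : a * b = b * a := by
  obtain ⟨c, hc0, h1, h2⟩ := exists_ne_zero_pairing σ he₀
  obtain ⟨c', -, -, hcc', -⟩ := exists_inverse_of_ne_zero he₀ hc0 h1 h2
  have h3 : e₀ * σ c = σ c := by
    rw [← σ.apply_apply e₀, ← apply_mul, h2]
  -- `z * c + σ (z * c)` is symmetric in `e₀A`, hence zero. The case `z = e₀` makes `c` skew, so `z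
  -- * c = c * σ z`: conjugation by `c` turns the antiautomorphism `σ` into the identity of the
  -- corner, which forces commutativity.
  have hcσ : ∀ z, e₀ * z = z → z * c = -(σ c * σ z) := fun z hz => by
    rw [← apply_mul]
    refine eq_neg_of_add_eq_zero_left (halt _ ?_ ?_)
    · rw [mul_add, ← mul_assoc, hz, apply_mul, ← mul_assoc, h3]
    · rw [map_add, apply_apply, add_comm]
  have hc : σ c = -c := by
    have := hcσ e₀ he₀.idem
    rw [h1, ← apply_mul, h1] at this
    exact (neg_eq_iff_eq_neg.2 this).symm
  have hz : ∀ z, e₀ * z = z → z * c = c * σ z := fun z hz => by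
    rw [hcσ z hz, hc, neg_mul, neg_neg]
  have hab : a * b * c = b * a * c := by
    rw [hz (a * b) (by rw [← mul_assoc, ha]), apply_mul, ← mul_assoc, ← hz b hb, mul_assoc b,
      mul_assoc b, ← hz a ha]
  have := congrArg (fun z => z * c') hab
  simp only [mul_assoc, hcc', ha', hb'] at this
  exact this

end

end LinInvolution

/-! ### Matrix models -/

section Matrix

theorem isDivisionIdempotent_symm_single {F : Type u} {A : Type v} {D : Type w} [Field F] [Ring A]
    [Algebra F A] [DivisionRing D] [Algebra F D] {n : ℕ} (ψ : A ≃ₐ[F] Matrix (Fin n) (Fin n) D)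
    (i : Fin n) : IsDivisionIdempotent (ψ.symm (Matrix.single i i 1)) where
  idem := by rw [← map_mul, Matrix.single_mul_single_same, one_mul]
  ne_zero := by
    rw [map_ne_zero_iff _ ψ.symm.injective]
    intro h
    have := congrFun (congrFun h i) i
    simp at this
  exists_inv a ha := by
    obtain ⟨M, rfl⟩ := ψ.symm.surjective a
    rw [← map_mul, ← map_mul, Matrix.single_mul_mul_single, one_mul, mul_one,
      map_ne_zero_iff _ ψ.symm.injective] at ha
    have hM : M i i ≠ 0 := fun h => ha (by rw [h, Matrix.single_zero])
    refine ⟨ψ.symm (Matrix.single i i (M i i)⁻¹), ?_⟩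
    simp only [← map_mul, Matrix.single_mul_mul_single, one_mul, mul_one,
      Matrix.single_mul_single_same, mul_inv_cancel₀ hM]

theorem rightIdealRank_symm_single {F : Type u} {A : Type v} [Field F] [Ring A] [Algebra F A]
    {n : ℕ} (ψ : A ≃ₐ[F] Matrix (Fin n) (Fin n) F) (i : Fin n) :
    rightIdealRank F (ψ.symm (Matrix.single i i 1)) = n := by
  let g : (Fin n → F) →ₗ[F] A := ψ.symm.toLinearMap ∘ₗ
    { toFun := fun f => Matrix.of fun a b => if a = i then f b else 0
      map_add' := fun f f' => by ext a b; by_cases h : a = i <;> simp [h]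
      map_smul' := fun r f => by ext a b; by_cases h : a = i <;> simp [h] }
  have hg : ∀ f, g f = ψ.symm (Matrix.of fun a b => if a = i then f b else 0) := fun _ => rfl
  have hinj : Function.Injective g := fun f f' h => by
    rw [hg, hg] at h
    ext b
    simpa using congrFun (congrFun (ψ.symm.injective h) i) b
  have hrow : ∀ M : Matrix (Fin n) (Fin n) F, Matrix.single i i 1 * M =
      Matrix.of fun a b => if a = i then M i b else 0 := fun M => by
    ext a b
    by_cases h : a = i
    · subst h; simp
    · simp [h]
  have hrange : LinearMap.range (LinearMap.mulLeft F (ψ.symm (Matrix.single i i 1))) =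
      LinearMap.range g := by
    ext z
    constructor
    · rintro ⟨a, rfl⟩
      obtain ⟨M, rfl⟩ := ψ.symm.surjective a
      exact ⟨M i, by rw [hg, LinearMap.mulLeft_apply, ← map_mul, hrow]⟩
    · rintro ⟨f, rfl⟩
      refine ⟨g f, ?_⟩
      rw [hg, LinearMap.mulLeft_apply, ← map_mul, hrow]
      simp
  rw [rightIdealRank, hrange, LinearMap.finrank_range_of_inj hinj, Module.finrank_fin_fun]

theorem csaDegree_eq_of_algEquiv {F : Type u} {A : Type v} [Field F] [Ring A] [Algebra F A]
    {n : ℕ} (ψ : A ≃ₐ[F] Matrix (Fin n) (Fin n) F) :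
    Module.finrank F A = n * n ∧ csaDegree F A = n := by
  have : Module.finrank F A = n * n := by
    rw [ψ.toLinearEquiv.finrank_eq, Module.finrank_matrix]; simp
  exact ⟨this, by rw [csaDegree, this, Nat.sqrt_eq]⟩

/-- If the diagonal corner of a central matrix algebra is commutative, the algebra is split. -/
theorem exists_algEquiv_of_central_of_commute {F : Type u} {A : Type v} {D : Type w} [Field F]
    [Ring A] [Algebra F A] [Algebra.IsCentral F A] [DivisionRing D] [Algebra F D] {n : ℕ}
    (ψ : A ≃ₐ[F] Matrix (Fin n) (Fin n) D) (i : Fin n) (hD : ∀ x y : D, x * y = y * x) :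
    ∃ ψ' : A ≃ₐ[F] Matrix (Fin n) (Fin n) F,
      ψ'.symm (Matrix.single i i 1) = ψ.symm (Matrix.single i i 1) := by
  have hsurj : Function.Surjective (Algebra.ofId F D) := fun x => by
    -- When `D` is commutative its scalar matrices are central in `A`, so `D` reduces to `F`.
    have hx : ψ.symm (Matrix.scalar (Fin n) x) ∈ Subalgebra.center F A := by
      rw [Subalgebra.mem_center_iff]
      intro a
      obtain ⟨M, rfl⟩ := ψ.symm.surjective a
      rw [← map_mul, ← map_mul, (Matrix.scalar_commute x (fun y => hD x y) M).eq]
    obtain ⟨r, hr⟩ := (Algebra.IsCentral.mem_center_iff F).1 hx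
    refine ⟨r, ?_⟩
    have h := congrArg ψ hr
    rw [AlgEquiv.apply_symm_apply, AlgEquiv.commutes] at h
    have h' := congrFun (congrFun h i) i
    rw [Matrix.algebraMap_matrix_apply] at h'
    simpa [Algebra.ofId_apply] using h'.symm
  let ε : F ≃ₐ[F] D := AlgEquiv.ofBijective (Algebra.ofId F D) ⟨(algebraMap F D).injective, hsurj⟩
  refine ⟨ψ.trans ε.symm.mapMatrix, ?_⟩
  rw [AlgEquiv.symm_apply_eq, AlgEquiv.trans_apply, AlgEquiv.apply_symm_apply]
  ext a b
  rw [AlgEquiv.mapMatrix_apply, Matrix.map_apply]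
  by_cases h : i = a ∧ i = b <;> simp [Matrix.single_apply, h]

end Matrix

/-! ### Assembling the cases -/

namespace LinInvolution

variable {F : Type u} {A : Type v} [Field F] [Ring A] [Algebra F A] [FiniteDimensional F A]
  [Algebra.IsCentral F A] [IsSimpleRing A] {σ : LinInvolution F A}

/-- Outside the exceptional case, `d` has a symmetric square root in `A` as soon as it has one in
the corner complementary to some hyperbolic idempotent. -/
theorem hasSymmSqrt_one_of_not_exceptional (h2 : (2 : F) ≠ 0) (d : F) (hσ : ¬ IsExceptionalCase σ)
    {e : A} (he : e * e = e) (heσ : e * σ e = 0) (hσe : σ e * e = 0)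
    (h : σ.HasSymmSqrt d (1 - (e + σ e))) : σ.HasSymmSqrt d 1 := by
  have : IsArtinianRing A := IsArtinianRing.of_finite F A
  obtain ⟨n, hn, D, _, _, ⟨ψ⟩⟩ := IsSimpleRing.exists_algEquiv_matrix_divisionRing F A
  obtain ⟨e₀, he₀def⟩ : ∃ e₀, e₀ = ψ.symm (Matrix.single 0 0 1) := ⟨_, rfl⟩
  have he₀ : IsDivisionIdempotent e₀ := he₀def ▸ isDivisionIdempotent_symm_single ψ 0
  by_cases halt : ∀ c, e₀ * c = c → σ c = c → c = 0
  · have hD : ∀ x y : D, x * y = y * x := fun x y => by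
      have hl : ∀ z : D, e₀ * ψ.symm (Matrix.single 0 0 z) = ψ.symm (Matrix.single 0 0 z) :=
        fun z => by rw [he₀def, ← map_mul, Matrix.single_mul_single_same, one_mul]
      have hr : ∀ z : D, ψ.symm (Matrix.single 0 0 z) * e₀ = ψ.symm (Matrix.single 0 0 z) :=
        fun z => by rw [he₀def, ← map_mul, Matrix.single_mul_single_same, mul_one]
      have hc := commute_of_alternating he₀ halt (hl x) (hr x) (hl y) (hr y)
      rw [← map_mul, ← map_mul, Matrix.single_mul_single_same, Matrix.single_mul_single_same] at hc
      have := congrFun (congrFun (ψ.symm.injective hc) 0) 0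
      simpa using this
    obtain ⟨ψ', hψ'⟩ := exists_algEquiv_of_central_of_commute ψ 0 hD
    rw [← he₀def] at hψ'
    obtain ⟨hdim, hdeg⟩ := csaDegree_eq_of_algEquiv ψ'
    obtain ⟨-, k, hk, hsqrt⟩ := hyperbolic_of_alternating he₀ halt d 1 (one_mul 1) σ.apply_one
    have hr : rightIdealRank F e₀ = n := hψ' ▸ rightIdealRank_symm_single ψ' 0
    rw [rightIdealRank_one, hdim, hr] at hk
    -- Comparing dimensions gives `n · n = 2k · n`; an odd `k` would then be exactly the exceptional
    -- case.
    have hnk : n = 2 * k := Nat.eq_of_mul_eq_mul_right (Nat.pos_of_ne_zero hn.out) hk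
    refine hsqrt ?_
    by_contra hodd
    refine hσ ⟨⟨n, ⟨ψ'⟩⟩, ?_, isSymplectic_of_alternating h2 he₀.idem he₀.ne_zero halt⟩
    rw [hdeg]
    rw [Nat.not_even_iff] at hodd
    omega
  · push Not at halt
    obtain ⟨c, h1, hc, h0⟩ := halt
    have hgood := hasSymmSqrt_of_symm_ne_zero he₀ h0 h1 hc d e he heσ hσe
    have hhyp : σ.IsHyperbolicIdempotent (e + σ e) := ⟨e, he, heσ, hσe, rfl⟩
    have := hgood.add h (by rw [mul_sub, mul_one, hhyp.idem, sub_self])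
      (by rw [sub_mul, one_mul, hhyp.idem, sub_self])
    rwa [add_sub_cancel] at this

omit [FiniteDimensional F A] [Algebra.IsCentral F A] [IsSimpleRing A] in
theorem IsHyperbolic.tensor {B : Type w} [Ring B] [Algebra F B] (h : σ.IsHyperbolic)
    (τ : LinInvolution F B) : (σ.tensor τ).IsHyperbolic := by
  obtain ⟨e, he, hσe⟩ := h
  refine ⟨e ⊗ₜ[F] 1, by rw [Algebra.TensorProduct.tmul_mul_tmul, he, one_mul], ?_⟩
  change σ e ⊗ₜ[F] τ 1 = _
  rw [hσe, apply_one, TensorProduct.sub_tmul, Algebra.TensorProduct.one_def]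

omit [FiniteDimensional F A] [Algebra.IsCentral F A] [IsSimpleRing A] in
/-- In the exceptional case the involution is adjoint to an alternating form. -/
theorem _root_.IsExceptionalCase.exists_isAlt (hσ : IsExceptionalCase σ) :
    ∃ (n : ℕ) (ψ : A ≃ₐ[F] Matrix (Fin n) (Fin n) F) (b : LinearMap.BilinForm F (Fin n → F)),
      n % 4 = 2 ∧ b.Nondegenerate ∧ b.IsAlt ∧ ∀ a x y, b x (Matrix.toLinAlgEquiv' (ψ a) y) =
        b (Matrix.toLinAlgEquiv' (ψ (σ a)) x) y := by
  obtain ⟨⟨n, ⟨ψ⟩⟩, hdeg, hsymp⟩ := hσ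
  rw [(csaDegree_eq_of_algEquiv ψ).2] at hdeg
  obtain ⟨b, hb, hadj⟩ := exists_adjoint_form σ (ψ.trans Matrix.toLinAlgEquiv')
  exact ⟨n, ψ, b, hdeg, hb, hsymp.isAlt _ hb hadj, hadj⟩

omit [Algebra.IsCentral F A] in
theorem _root_.IsExceptionalCase.isHyperbolic (h2 : (2 : F) ≠ 0) (hσ : IsExceptionalCase σ) :
    σ.IsHyperbolic := by
  obtain ⟨n, ψ, b, hn, hb, halt, hadj⟩ := hσ.exists_isAlt
  have : NeZero n := ⟨by rintro rfl; simp at hn⟩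
  -- Only the hyperbolic idempotent is needed, so the value `d = 0` is a dummy.
  obtain ⟨⟨e, he, -, -, h⟩, -⟩ := hyperbolic_of_alternating
    (isDivisionIdempotent_symm_single ψ 0)
    (fun c hc hσc => alternating_of_isAlt h2 ψ 0 hb halt hadj hc hσc) 0 1 (one_mul 1) σ.apply_one
  exact ⟨e, he, eq_sub_of_add_eq' h⟩

end LinInvolution

theorem theorem3p1 {F : Type u} {K : Type w} {A : Type v}
    [Field F] (hchar : ringChar F ≠ 2)
    [Field K] [Algebra F K] (hK : Module.finrank F K = 2)
    (ι : K ≃ₐ[F] K) (hι : ι ≠ AlgEquiv.refl)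
    [Ring A] [Algebra F A] [FiniteDimensional F A] [Algebra.IsCentral F A] [IsSimpleRing A]
    (σ : LinInvolution F A) :
    ((LinInvolution.identity F K).Embeds σ →
      (σ.tensor (LinInvolution.ofQuadratic hK ι)).IsHyperbolic) ∧
    (¬ IsExceptionalCase σ →
      (σ.tensor (LinInvolution.ofQuadratic hK ι)).IsHyperbolic →
      (LinInvolution.identity F K).Embeds σ) ∧
    (IsExceptionalCase σ →
      (σ.tensor (LinInvolution.ofQuadratic hK ι)).IsHyperbolic ∧
      ¬ (LinInvolution.identity F K).Embeds σ) := by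
  have h2 : (2 : F) ≠ 0 := Ring.two_ne_zero hchar
  obtain ⟨α, d, π₀, π₁, hd, hα, hια, hdec, h01, h0α, h11, h1α⟩ :=
    exists_quadratic_generator h2 hK ι hι
  refine ⟨LinInvolution.isHyperbolic_tensor_of_embeds h2 hK hd hα hια, fun hσ h => ?_,
    fun hσ => ⟨(hσ.isHyperbolic h2).tensor _, ?_⟩⟩
  · obtain ⟨x, y, hx, hy, hsq, hxy⟩ := LinInvolution.exists_anticommuting_of_isHyperbolic_tensor
      hK hα hια hdec h01 h0α h11 h1α h
    obtain ⟨e, he, heσ, hσe, hs⟩ :=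
      LinInvolution.exists_isotropic_idempotent_hasSymmSqrt_compl h2 hx hy hsq hxy
    exact LinInvolution.embeds_of_hasSymmSqrt_one hα hdec h01 h0α h11 h1α
      (LinInvolution.hasSymmSqrt_one_of_not_exceptional h2 d hσ he heσ hσe hs)
  · rintro ⟨f, -, hf⟩
    obtain ⟨n, ψ, b, hn, hb, halt, hadj⟩ := hσ.exists_isAlt
    have h4 := four_dvd_finrank_of_selfadjoint_quadratic h2 hK hα hdec h11 h1α b hb halt
      ((ψ.trans Matrix.toLinAlgEquiv').toAlgHom.comp f) fun k x y => by
        have := hadj (f k) x y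
        rw [← hf k] at this
        exact this
    rw [Module.finrank_fin_fun] at h4
    omega
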